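/- Let $X$ be a complex manifold (Hausdorff, paracompact, of pure finite dimension) and let $\mathcal F$ be a smooth (nonsingular) holomorphic foliation of codimension one on $X$, that is, an involutive holomorphic subbundle $T_{\mathcal F}\subset T_X$ of corank one. Let $N^*_{\mathcal F}\subset\Omega^1_X$ be its conormal sheaf, the sheaf of holomorphic $1$-forms vanishing on $T_{\mathcal F}$, and let $\nabla_B$ be the Bott connection on $N^*_{\mathcal F}$, the partial connection given by $$(\nabla_B)_v(\omega)=\mathcal L_v\omega,\qquad (\mathcal L_v\omega)(w)=v(\omega(w))-\omega([v,w])\qquad (v\in T_{\mathcal F},\ \omega\in N^*_{\mathcal F},\ w\in T_X).$$ Call $\mathcal F$ *transversely affine* if there are an open covering $\{U_i\}$ of $X$ and holomorphic submersions $f_i:U_i\to\mathbb C$ with $\ker df_i=T_{\mathcal F}|_{U_i}$ such that for all $i,j$ there are constants $a_{ij}\in\mathbb C^*$, $b_{ij}\in\mathbb C$ with $f_i=a_{ij}f_j+b_{ij}$ on $U_i\cap U_j$. Then $\mathcal F$ is transversely affine if and only if there is a flat holomorphic connection $\nabla:N^*_{\mathcal F}\to\Omega^1_X(N^*_{\mathcal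 F})=\mathcal Hom(T_X,N^*_{\mathcal F})$ (a $\mathbb C$-linear morphism of sheaves satisfying the Leibniz rule, with $\nabla_{[v,w]}=\nabla_v\nabla_w-\nabla_w\nabla_v$ for all $v,w\in T_X$) which extends the Bott connection, i.e. $\nabla_v\omega=(\nabla_B)_v\omega$ for all $v\in T_{\mathcal F}$ and $\omega\in N^*_{\mathcal F}$. -/

import Mathlib

open scoped Manifold ContDiff Topology

universe u v

section HolomorphicSections

variable {E : Type u} [NormedAddCommGroup E] [NormedSpace ℂ E]
  {M : Type v} [TopologicalSpace M] [ChartedSpace E M] [IsManifold 𝓘(ℂ, E) ∞ M]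

/-! Everything below takes place on a complex manifold `M` modelled on the complex vector space `E`.
Over `ℂ`, "of class `C^∞`" means infinitely complex differentiable, that is, holomorphic.

A section of a sheaf over an open set `U` is represented by a function on all of `M`, of which only
the values on `U` matter: every condition and every equation is imposed on `U` only. -/

variable (E) in
/-- `f` restricts to an element of `𝒪_M(U)`. -/
def IsHolFun (U : TopologicalSpace.Opens M) (f : M → ℂ) : Prop :=
  ContMDiffOn 𝓘(ℂ, E) 𝓘(ℂ, ℂ) ∞ f U

/-- `v` restricts to a holomorphic vector field on `U`, an element of `T_M(U)`. -/
def IsHolField (U : TopologicalSpace.Opens M) (v : (x : M) → TangentSpace 𝓘(ℂ, E) x) : Prop :=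
  ContMDiffOn 𝓘(ℂ, E) (𝓘(ℂ, E).prod 𝓘(ℂ, E)) ∞
    (fun x ↦ (⟨x, v x⟩ : TangentBundle 𝓘(ℂ, E) M)) U

/-- `η` restricts to a holomorphic 1-form on `U`, an element of `Ω¹_M(U)`: it is a holomorphic
section of the bundle `Hom(TM, ℂ)`. -/
def IsHolForm (U : TopologicalSpace.Opens M) (η : (x : M) → TangentSpace 𝓘(ℂ, E) x →L[ℂ] ℂ) :
    Prop :=
  ContMDiffOn 𝓘(ℂ, E) (𝓘(ℂ, E).prod 𝓘(ℂ, E →L[ℂ] ℂ)) ∞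
    (fun x ↦ (⟨x, η x⟩ : Bundle.TotalSpace (E →L[ℂ] ℂ)
      (fun x : M ↦ TangentSpace 𝓘(ℂ, E) x →L[ℂ] Bundle.Trivial M ℂ x))) U

/-- The derivative `v(f)` of the function `f` along the vector field `v`. -/
noncomputable def fieldDeriv (v : (x : M) → TangentSpace 𝓘(ℂ, E) x) (f : M → ℂ) (x : M) : ℂ :=
  mfderiv 𝓘(ℂ, E) 𝓘(ℂ, ℂ) f x (v x)

/-- The Lie derivative `ℒ_v η`, evaluated on the vector field `w`:
`(ℒ_v η)(w) = v(η(w)) - η([v, w])`. -/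
noncomputable def lieDerivForm (v : (x : M) → TangentSpace 𝓘(ℂ, E) x)
    (η : (x : M) → TangentSpace 𝓘(ℂ, E) x →L[ℂ] ℂ) (w : (x : M) → TangentSpace 𝓘(ℂ, E) x)
    (x : M) : ℂ :=
  fieldDeriv v (fun y ↦ η y (w y)) x - η x (VectorField.mlieBracket 𝓘(ℂ, E) v w x)

end HolomorphicSections

/-- A smooth (that is, nonsingular) holomorphic foliation of codimension one on `M`, given by its
tangent bundle: an involutive holomorphic subbundle of `TM` of corank one. -/
structure CodimOneFoliation (E : Type u) [NormedAddCommGroup E] [NormedSpace ℂ E]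
    (M : Type v) [TopologicalSpace M] [ChartedSpace E M]
    [IsManifold 𝓘(ℂ, E) ∞ M] where
  /-- the tangent space of the foliation at a point -/
  tangent : (x : M) → Submodule ℂ (TangentSpace 𝓘(ℂ, E) x)
  /-- the codimension is one -/
  codim_one : ∀ x, Module.finrank ℂ (TangentSpace 𝓘(ℂ, E) x ⧸ tangent x) = 1
  /-- the tangent spaces form a holomorphic subbundle: there are local holomorphic frames -/
  exists_frame : ∀ x : M, ∃ U : TopologicalSpace.Opens M, x ∈ U ∧
    ∃ (d : ℕ) (v : Fin d → (y : M) → TangentSpace 𝓘(ℂ, E) y),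
      (∀ i, IsHolField U (v i)) ∧
      ∀ y ∈ U, LinearIndependent ℂ (fun i ↦ v i y) ∧
        Submodule.span ℂ (Set.range (fun i ↦ v i y)) = tangent y
  /-- the tangent sheaf is closed under the Lie bracket -/
  involutive : ∀ (U : TopologicalSpace.Opens M) (v w : (x : M) → TangentSpace 𝓘(ℂ, E) x),
    IsHolField U v → IsHolField U w → (∀ x ∈ U, v x ∈ tangent x) → (∀ x ∈ U, w x ∈ tangent x) →
    ∀ x ∈ U, VectorField.mlieBracket 𝓘(ℂ, E) v w x ∈ tangent x

namespace CodimOneFoliation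

variable {E : Type u} [NormedAddCommGroup E] [NormedSpace ℂ E]
  {M : Type v} [TopologicalSpace M] [ChartedSpace E M] [IsManifold 𝓘(ℂ, E) ∞ M]

/-- `v` restricts to a section over `U` of the tangent sheaf `T_F`. -/
def IsTangentField (F : CodimOneFoliation E M) (U : TopologicalSpace.Opens M)
    (v : (x : M) → TangentSpace 𝓘(ℂ, E) x) : Prop :=
  IsHolField U v ∧ ∀ x ∈ U, v x ∈ F.tangent x

/-- `η` restricts to a section over `U` of the conormal sheaf `N*_F`: a holomorphic 1-form on `U`
which vanishes on the tangent spaces of the foliation. -/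
def IsConormal (F : CodimOneFoliation E M) (U : TopologicalSpace.Opens M)
    (η : (x : M) → TangentSpace 𝓘(ℂ, E) x →L[ℂ] ℂ) : Prop :=
  IsHolForm U η ∧ ∀ x ∈ U, ∀ w ∈ F.tangent x, η x w = 0

/-- A transversely affine structure: an open covering `U i` and holomorphic submersions
`φ i : U i → ℂ` defining the foliation, such that on each `U i ∩ U j` the maps `φ i` and `φ j`
differ by an element of the affine group of `ℂ`. -/
structure TransverselyAffineStructure (F : CodimOneFoliation E M) where
  ι : Type v
  U : ι → TopologicalSpace.Opens M
  φ : ι → M → ℂ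
  covers : ∀ x, ∃ i, x ∈ U i
  holomorphic : ∀ i, IsHolFun E (U i) (φ i)
  submersion : ∀ i, ∀ x ∈ U i, Function.Surjective (mfderiv 𝓘(ℂ, E) 𝓘(ℂ, ℂ) (φ i) x)
  ker_eq : ∀ i, ∀ x ∈ U i, ∀ w : TangentSpace 𝓘(ℂ, E) x,
    mfderiv 𝓘(ℂ, E) 𝓘(ℂ, ℂ) (φ i) x w = 0 ↔ w ∈ F.tangent x
  affine : ∀ i j, ∃ a b : ℂ, a ≠ 0 ∧ ∀ x ∈ U i ⊓ U j, φ i x = a * φ j x + b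

/-- The foliation is transversely affine. -/
def IsTransverselyAffine (F : CodimOneFoliation E M) : Prop :=
  Nonempty F.TransverselyAffineStructure

/-- A holomorphic connection `∇ : N*_F → Ω¹_M(N*_F) = Hom(T_M, N*_F)` on the conormal sheaf, as a
morphism of sheaves: `cov U v η` is `∇_v η`, for `v ∈ T_M(U)` and `η ∈ N*_F(U)`.
(Linearity over the constants is the Leibniz rule for constant `f`.) -/
structure ConormalConnection (F : CodimOneFoliation E M) where
  cov : TopologicalSpace.Opens M → ((x : M) → TangentSpace 𝓘(ℂ, E) x) →
    ((x : M) → TangentSpace 𝓘(ℂ, E) x →L[ℂ] ℂ) → (x : M) → TangentSpace 𝓘(ℂ, E) x →L[ℂ] ℂ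
  isConormal : ∀ U v η, IsHolField U v → F.IsConormal U η → F.IsConormal U (cov U v η)
  /-- `∇` is compatible with restriction to smaller open sets
  (and, for `V = U`, depends on the values on `U` only) -/
  restrict : ∀ U V v v' η η', V ≤ U → IsHolField U v → F.IsConormal U η →
    IsHolField V v' → F.IsConormal V η' → (∀ x ∈ V, v x = v' x) → (∀ x ∈ V, η x = η' x) →
    ∀ x ∈ V, cov U v η x = cov V v' η' x
  add_field : ∀ U v w η, IsHolField U v → IsHolField U w → F.IsConormal U η →
    ∀ x ∈ U, cov U (fun y ↦ v y + w y) η x = cov U v η x + cov U w η x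
  smul_field : ∀ U f v η, IsHolFun E U f → IsHolField U v → F.IsConormal U η →
    ∀ x ∈ U, cov U (fun y ↦ f y • v y) η x = f x • cov U v η x
  add_form : ∀ U v η θ, IsHolField U v → F.IsConormal U η → F.IsConormal U θ →
    ∀ x ∈ U, cov U v (fun y ↦ η y + θ y) x = cov U v η x + cov U v θ x
  leibniz : ∀ U f v η, IsHolFun E U f → IsHolField U v → F.IsConormal U η →
    ∀ x ∈ U, cov U v (fun y ↦ f y • η y) x = fieldDeriv v f x • η x + f x • cov U v η x

/-- The connection is flat: `∇_[v,w] = ∇_v ∘ ∇_w - ∇_w ∘ ∇_v`. -/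
def ConormalConnection.IsFlat {F : CodimOneFoliation E M} (C : F.ConormalConnection) : Prop :=
  ∀ U v w η, IsHolField U v → IsHolField U w → F.IsConormal U η →
    ∀ x ∈ U, C.cov U (VectorField.mlieBracket 𝓘(ℂ, E) v w) η x =
      C.cov U v (C.cov U w η) x - C.cov U w (C.cov U v η) x

/-- The connection extends the Bott connection `∇_B` of the conormal sheaf, which is the partial
connection `(∇_B)_v η = ℒ_v η` for `v ∈ T_F(U)` and `η ∈ N*_F(U)`. -/
def ConormalConnection.ExtendsBott {F : CodimOneFoliation E M} (C : F.ConormalConnection) : Prop :=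
  ∀ U v η w, F.IsTangentField U v → F.IsConormal U η → IsHolField U w →
    ∀ x ∈ U, C.cov U v η x (w x) = lieDerivForm v η w x

end CodimOneFoliation

/-! The conormal sheaf is a line bundle, and a transversely affine structure amounts to a choice of
local parallel frames for it.

Given distinguished submersions `φ i`, the forms `dφ i` are frames that differ by constant factors
on overlaps (`differential_eq_smul`). So `∇_v (g dφ i) = v(g) dφ i` does not depend on `i`
(`parallelCov_eq`). It is flat because `[v, w](g) = v(w(g)) - w(v(g))`, and it extends the Bott
connection because `v(φ i) = 0` for `v` tangent to the foliation.

Conversely, write a flat connection in a local frame as `∇η = θ ⊗ η`. Flatness says `dθ = 0`, so `θ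
= dh` on a ball and `exp(-h) η` is parallel (`exists_isParallel`). A parallel frame `η` of a
connection extending Bott is closed (`IsParallel.closed`): for `v` tangent, `dη(v, ·) = ℒ_v η = ∇_v
η = 0`, and an alternating form killed by a hyperplane is zero. Hence `η = df` on the ball. Two such
`f` and `g` on a connected set have `df = ρ dg` with `ρ` constant, by the Leibniz rule, so they
differ by an affine map (`IsParallel.affine`).

One global point remains: the constants must be uniform on each overlap, which may be disconnected.
A star refinement of the cover (`exists_star_refinement`) puts any two intersecting balls inside the
domain of a third submersion, with which both are compared; this uses that `M` is Hausdorff and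
paracompact. -/

set_option linter.unusedSectionVars false

/-! ### Holomorphic sections and coordinate vector fields. -/

section HolomorphicCalculus

open TopologicalSpace (Opens)

variable {E : Type u} [NormedAddCommGroup E] [NormedSpace ℂ E]
  {M : Type v} [TopologicalSpace M] [ChartedSpace E M] [IsManifold 𝓘(ℂ, E) ∞ M]

lemma IsHolFun.contMDiffAt {U : Opens M} {f : M → ℂ} (hf : IsHolFun E U f) {x : M} (hx : x ∈ U) :
    ContMDiffAt 𝓘(ℂ, E) 𝓘(ℂ, ℂ) ∞ f x :=
  ContMDiffOn.contMDiffAt hf (U.isOpen.mem_nhds hx)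

lemma IsHolFun.mdifferentiableAt {U : Opens M} {f : M → ℂ} (hf : IsHolFun E U f) {x : M}
    (hx : x ∈ U) : MDifferentiableAt 𝓘(ℂ, E) 𝓘(ℂ, ℂ) f x :=
  (hf.contMDiffAt hx).mdifferentiableAt (by simp)

lemma IsHolFun.mono {U V : Opens M} {f : M → ℂ} (hf : IsHolFun E U f) (h : V ≤ U) :
    IsHolFun E V f :=
  ContMDiffOn.mono hf h

lemma IsHolField.contMDiffAt {U : Opens M} {v : (x : M) → TangentSpace 𝓘(ℂ, E) x}
    (hv : IsHolField U v) {x : M} (hx : x ∈ U) :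
    ContMDiffAt 𝓘(ℂ, E) (𝓘(ℂ, E).prod 𝓘(ℂ, E)) ∞
    (fun x ↦ (⟨x, v x⟩ : TangentBundle 𝓘(ℂ, E) M)) x :=
  ContMDiffOn.contMDiffAt hv (U.isOpen.mem_nhds hx)

lemma IsHolField.mono {U V : Opens M} {v : (x : M) → TangentSpace 𝓘(ℂ, E) x}
    (hv : IsHolField U v) (h : V ≤ U) : IsHolField V v :=
  ContMDiffOn.mono hv h

lemma IsHolForm.mono {U V : Opens M} {η : (x : M) → TangentSpace 𝓘(ℂ, E) x →L[ℂ] ℂ}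
    (hη : IsHolForm U η) (h : V ≤ U) : IsHolForm V η :=
  ContMDiffOn.mono hη h

lemma IsHolForm.apply {U : Opens M} {η : (x : M) → TangentSpace 𝓘(ℂ, E) x →L[ℂ] ℂ}
    {v : (x : M) → TangentSpace 𝓘(ℂ, E) x} (hη : IsHolForm U η) (hv : IsHolField U v) :
    IsHolFun E U (fun x ↦ η x (v x)) := by
  intro x hx
  have h := ContMDiffWithinAt.clm_bundle_apply (E₂ := Bundle.Trivial M ℂ) (hη x hx) (hv x hx)
  rw [Bundle.contMDiffWithinAt_section] at h
  exact h

/-- The domain of the preferred chart at `x`. -/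
def chartDomain (E : Type u) [NormedAddCommGroup E] {M : Type v} [TopologicalSpace M]
    [ChartedSpace E M] (x : M) : Opens M :=
  ⟨(chartAt E x).source, (chartAt E x).open_source⟩

/-- The differential at `y` of the preferred chart at `x`. -/
noncomputable def chartDeriv (x y : M) : TangentSpace 𝓘(ℂ, E) y →L[ℂ] E :=
  mfderiv 𝓘(ℂ, E) 𝓘(ℂ, E) (extChartAt 𝓘(ℂ, E) x) y

/-- A constant vector field on `E`. -/
def constField (e : E) : (z : E) → TangentSpace 𝓘(ℂ, E) z := fun _ ↦ e

/-- The coordinate vector field in the direction of `e` of the preferred chart at `x`. -/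
noncomputable def coordField (x : M) (e : E) : (y : M) → TangentSpace 𝓘(ℂ, E) y :=
  VectorField.mpullback 𝓘(ℂ, E) 𝓘(ℂ, E) (extChartAt 𝓘(ℂ, E) x) (constField e)

lemma isInvertible_mfderiv_chart {x y : M} (hy : y ∈ chartDomain E x) :
    (mfderiv 𝓘(ℂ, E) 𝓘(ℂ, E) (extChartAt 𝓘(ℂ, E) x) y).IsInvertible :=
  isInvertible_mfderiv_extChartAt (by rw [extChartAt_source]; exact hy)

lemma isInvertible_chartDeriv {x y : M} (hy : y ∈ chartDomain E x) :
    (chartDeriv x y : TangentSpace 𝓘(ℂ, E) y →L[ℂ] E).IsInvertible :=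
  isInvertible_mfderiv_chart hy

lemma coordField_apply (x y : M) (e : E) :
    coordField x e y = (chartDeriv x y : TangentSpace 𝓘(ℂ, E) y →L[ℂ] E).inverse e :=
  rfl

lemma chartDeriv_coordField {x y : M} (hy : y ∈ chartDomain E x) (e : E) :
    chartDeriv x y (coordField x e y) = e := by
  obtain ⟨A, hA⟩ := isInvertible_chartDeriv hy
  rw [coordField_apply, ← hA, ContinuousLinearMap.inverse_equiv]
  exact A.apply_symm_apply e

lemma coordField_chartDeriv {x y : M} (hy : y ∈ chartDomain E x) (w : TangentSpace 𝓘(ℂ, E) y) :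
    coordField x (chartDeriv x y w) y = w := by
  obtain ⟨A, hA⟩ := isInvertible_chartDeriv hy
  rw [coordField_apply, ← hA, ContinuousLinearMap.inverse_equiv]
  exact A.symm_apply_apply w

lemma mlieBracket_eq_lieBracket (v w : (x : E) → TangentSpace 𝓘(ℂ, E) x) (z : E) :
    VectorField.mlieBracket 𝓘(ℂ, E) v w z = VectorField.lieBracket ℂ (v : E → E) (w : E → E) z := by
  rw [← VectorField.mlieBracketWithin_univ, VectorField.mlieBracketWithin_eq_lieBracketWithin]
  exact congrFun (VectorField.lieBracketWithin_univ (𝕜 := ℂ) (V := (v : E → E))) z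

variable [CompleteSpace E]

lemma contMDiffAt_constField (e z : E) : ContMDiffAt 𝓘(ℂ, E) (𝓘(ℂ, E).prod 𝓘(ℂ, E)) ∞
      (fun z ↦ (⟨z, constField e z⟩ : TangentBundle 𝓘(ℂ, E) E)) z :=
  contMDiffAt_vectorSpace_iff_contDiffAt.2 contDiffAt_const

lemma isHolField_coordField (x : M) (e : E) : IsHolField (chartDomain E x) (coordField x e) := by
  intro y hy
  exact (ContMDiffAt.mpullback_vectorField_preimage (n := ∞) (contMDiffAt_constField _ _)
    (contMDiffAt_extChartAt' hy) (isInvertible_mfderiv_chart hy) le_rfl).contMDiffWithinAt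

/-- Coordinate fields are pullbacks of constant fields, and pullback commutes with the bracket. In
the flatness identity this removes the bracket term. -/
lemma mlieBracket_coordField {x y : M} (hy : y ∈ chartDomain E x) (a b : E) :
    VectorField.mlieBracket 𝓘(ℂ, E) (coordField x a) (coordField x b) y = 0 := by
  have hc : ∀ e : E, MDifferentiableAt 𝓘(ℂ, E) (𝓘(ℂ, E).prod 𝓘(ℂ, E))
      (fun z ↦ (⟨z, constField e z⟩ : TangentBundle 𝓘(ℂ, E) E)) (extChartAt 𝓘(ℂ, E) x y) := fun e ↦
    (contMDiffAt_constField e _).mdifferentiableAt (by simp)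
  have : IsManifold 𝓘(ℂ, E) (minSmoothness ℂ 3) M := by
    simp only [minSmoothness_of_isRCLikeNormedField]; infer_instance
  have h := VectorField.mpullback_mlieBracket (n := ∞) (I := 𝓘(ℂ, E)) (I' := 𝓘(ℂ, E)) (hc a) (hc b)
    (contMDiffAt_extChartAt' hy) (by
      simp only [minSmoothness_of_isRCLikeNormedField]; exact ENat.LEInfty.out)
  refine h.symm.trans ?_
  have h0 : VectorField.mlieBracket 𝓘(ℂ, E) (constField a) (constField b) (extChartAt 𝓘(ℂ, E) x y)
      = 0 := by
    rw [mlieBracket_eq_lieBracket]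
    have (e : E) : fderiv ℂ (constField e : E → E) = 0 := fderiv_const e
    simp only [VectorField.lieBracket, this]
    exact sub_self (0 : E)
  rw [VectorField.mpullback_apply, h0, map_zero]

end HolomorphicCalculus

/-! ### Functions, fields and forms read in a chart. -/

section ChartCalculus

open TopologicalSpace (Opens)

variable {E : Type u} [NormedAddCommGroup E] [NormedSpace ℂ E]
  {M : Type v} [TopologicalSpace M] [ChartedSpace E M] [IsManifold 𝓘(ℂ, E) ∞ M]

lemma IsHolForm.of_local {U : Opens M} {η : (x : M) → TangentSpace 𝓘(ℂ, E) x →L[ℂ] ℂ}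
    (h : ∀ x ∈ U, ∃ V : Opens M, x ∈ V ∧ IsHolForm V η) : IsHolForm U η := by
  intro x hx
  obtain ⟨V, hxV, hV⟩ := h x hx
  exact (ContMDiffOn.contMDiffAt hV (V.isOpen.mem_nhds hxV)).contMDiffWithinAt

lemma IsHolFun.congr {U : Opens M} {f g : M → ℂ} (hf : IsHolFun E U f)
    (h : ∀ x ∈ U, g x = f x) : IsHolFun E U g :=
  ContMDiffOn.congr hf h

lemma IsHolField.congr {U : Opens M} {v w : (x : M) → TangentSpace 𝓘(ℂ, E) x}
    (hv : IsHolField U v) (h : ∀ x ∈ U, w x = v x) : IsHolField U w :=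
  ContMDiffOn.congr hv fun x hx ↦ by rw [h x hx]

lemma IsHolForm.congr {U : Opens M} {η θ : (x : M) → TangentSpace 𝓘(ℂ, E) x →L[ℂ] ℂ}
    (hη : IsHolForm U η) (h : ∀ x ∈ U, θ x = η x) : IsHolForm U θ :=
  ContMDiffOn.congr hη fun x hx ↦ by rw [h x hx]

/-- The inverse of the preferred chart at `x`. -/
noncomputable def invChart (E : Type u) [NormedAddCommGroup E] [NormedSpace ℂ E]
    {M : Type v} [TopologicalSpace M] [ChartedSpace E M] (x : M) : E → M :=
  (extChartAt 𝓘(ℂ, E) x).symm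

/-- The image of the preferred chart at `x`. -/
def chartTarget (E : Type u) [NormedAddCommGroup E]
    {M : Type v} [TopologicalSpace M] [ChartedSpace E M] (x : M) : Set E :=
  (chartAt E x).target

lemma isOpen_chartTarget (x : M) : IsOpen (chartTarget E x) := (chartAt E x).open_target

lemma invChart_mem {x : M} {z : E} (hz : z ∈ chartTarget E x) :
    invChart E x z ∈ chartDomain E x := by
  change _ ∈ (chartAt E x).source
  simpa [invChart] using (chartAt E x).map_target hz

lemma chart_invChart {x : M} {z : E} (hz : z ∈ chartTarget E x) :
    extChartAt 𝓘(ℂ, E) x (invChart E x z) = z := by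
  simpa [invChart] using (chartAt E x).right_inv hz

lemma invChart_chart {x y : M} (hy : y ∈ chartDomain E x) :
    invChart E x (extChartAt 𝓘(ℂ, E) x y) = y := by
  simpa [invChart] using (chartAt E x).left_inv hy

lemma chart_mem {x y : M} (hy : y ∈ chartDomain E x) :
    extChartAt 𝓘(ℂ, E) x y ∈ chartTarget E x := by
  change _ ∈ (chartAt E x).target
  simpa using (chartAt E x).map_source hy

lemma contMDiffAt_invChart {x : M} {z : E} (hz : z ∈ chartTarget E x) :
    ContMDiffAt 𝓘(ℂ, E) 𝓘(ℂ, E) ∞ (invChart E x) z :=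
  (contMDiffOn_extChartAt_symm x).contMDiffAt
    (by rw [extChartAt_target]; simpa using (chartAt E x).open_target.mem_nhds hz)

lemma continuousAt_invChart {x : M} {z : E} (hz : z ∈ chartTarget E x) :
    ContinuousAt (invChart E x) z :=
  (contMDiffAt_invChart hz).continuousAt

lemma IsHolFun.contDiffAt {U : Opens M} {f : M → ℂ} (hf : IsHolFun E U f) {x : M} {z : E}
    (hz : z ∈ chartTarget E x) (hU : invChart E x z ∈ U) :
    ContDiffAt ℂ ∞ (fun z ↦ f (invChart E x z)) z :=
  contMDiffAt_iff_contDiffAt.1 ((hf.contMDiffAt hU).comp z (contMDiffAt_invChart hz))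

lemma hasMFDerivAt_chart {x y : M} (hy : y ∈ chartDomain E x) :
    HasMFDerivAt 𝓘(ℂ, E) 𝓘(ℂ, E) (extChartAt 𝓘(ℂ, E) x) y (chartDeriv x y) :=
  (mdifferentiableAt_extChartAt hy).hasMFDerivAt

/-- The differential of a function, as a 1-form. -/
noncomputable def differential (f : M → ℂ) (x : M) : TangentSpace 𝓘(ℂ, E) x →L[ℂ] ℂ :=
  mfderiv 𝓘(ℂ, E) 𝓘(ℂ, ℂ) f x

lemma differential_comp_chart {x y : M} (hy : y ∈ chartDomain E x) {g : E → ℂ} {g' : E →L[ℂ] ℂ}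
    (hg : HasFDerivAt g g' (extChartAt 𝓘(ℂ, E) x y)) :
    differential (fun y ↦ g (extChartAt 𝓘(ℂ, E) x y)) y = g'.comp (chartDeriv x y) :=
  (hg.hasMFDerivAt.comp y (hasMFDerivAt_chart hy)).mfderiv

lemma differential_congr {f g : M → ℂ} {x : M} (h : f =ᶠ[𝓝 x] g) :
    (differential f x : TangentSpace 𝓘(ℂ, E) x →L[ℂ] ℂ) = differential g x :=
  h.mfderiv_eq

lemma IsHolFun.differential_eq {U : Opens M} {f : M → ℂ} (hf : IsHolFun E U f) {x y : M}
    (hy : y ∈ chartDomain E x) (hU : y ∈ U) :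
    differential f y = (fderiv ℂ (fun z ↦ f (invChart E x z)) (extChartAt 𝓘(ℂ, E) x y)).comp
      (chartDeriv x y) := by
  have hd := hf.contDiffAt (chart_mem hy) ((invChart_chart hy).symm ▸ hU)
  rw [← differential_comp_chart hy (hd.differentiableAt (by simp)).hasFDerivAt]
  apply differential_congr
  filter_upwards [(chartDomain E x).isOpen.mem_nhds hy] with z hz
  rw [invChart_chart hz]

lemma IsHolFun.differential_coordField {U : Opens M} {f : M → ℂ} (hf : IsHolFun E U f) {x y : M}
    (hy : y ∈ chartDomain E x) (hU : y ∈ U) (e : E) :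
    differential f y (coordField x e y) =
      fderiv ℂ (fun z ↦ f (invChart E x z)) (extChartAt 𝓘(ℂ, E) x y) e := by
  rw [hf.differential_eq hy hU, ContinuousLinearMap.comp_apply, chartDeriv_coordField hy]

/-- The expression of a vector field in the preferred chart at `x`. -/
noncomputable def pullField (x : M) (v : (x : M) → TangentSpace 𝓘(ℂ, E) x) (z : E) : E :=
  chartDeriv x (invChart E x z) (v (invChart E x z))

/-- The expression of a 1-form in the preferred chart at `x`. -/
noncomputable def pullForm (x : M) (η : (x : M) → TangentSpace 𝓘(ℂ, E) x →L[ℂ] ℂ) (z : E) :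
    E →L[ℂ] ℂ :=
  (η (invChart E x z)).comp
    (chartDeriv x (invChart E x z) : TangentSpace 𝓘(ℂ, E) (invChart E x z) →L[ℂ] E).inverse

lemma pullForm_apply (x : M) (η : (x : M) → TangentSpace 𝓘(ℂ, E) x →L[ℂ] ℂ) (z e : E) :
    pullForm x η z e = η (invChart E x z) (coordField x e (invChart E x z)) :=
  rfl

lemma pullForm_pullField {x : M} (η : (x : M) → TangentSpace 𝓘(ℂ, E) x →L[ℂ] ℂ)
    (v : (x : M) → TangentSpace 𝓘(ℂ, E) x) {z : E} (hz : z ∈ chartTarget E x) :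
    pullForm x η z (pullField x v z) = η (invChart E x z) (v (invChart E x z)) := by
  rw [pullForm_apply, pullField, coordField_chartDeriv (invChart_mem hz)]

lemma isHolFun_of_contDiffAt {x : M} {U : Opens M} (hU : U ≤ chartDomain E x) {g : E → ℂ}
    (hg : ∀ y ∈ U, ContDiffAt ℂ ∞ g (extChartAt 𝓘(ℂ, E) x y)) :
    IsHolFun E U (fun y ↦ g (extChartAt 𝓘(ℂ, E) x y)) := fun y hy ↦
  ((hg y hy).contMDiffAt.comp y (contMDiffAt_extChartAt' (hU hy))).contMDiffWithinAt

variable [FiniteDimensional ℂ E]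

lemma IsHolForm.contDiffAt_pullForm {U : Opens M} {η : (x : M) → TangentSpace 𝓘(ℂ, E) x →L[ℂ] ℂ}
    (hη : IsHolForm U η) {x : M} {z : E} (hz : z ∈ chartTarget E x) (hU : invChart E x z ∈ U) :
    ContDiffAt ℂ ∞ (pullForm x η) z := by
  have : CompleteSpace E := FiniteDimensional.complete ℂ E
  have hopen : IsOpen (chartTarget E x ∩ invChart E x ⁻¹' U) :=
    ContinuousOn.isOpen_inter_preimage
      (fun z hz ↦ (continuousAt_invChart hz).continuousWithinAt) (isOpen_chartTarget x) U.isOpen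
  refine ContDiffOn.contDiffAt (s := chartTarget E x ∩ invChart E x ⁻¹' U) ?_
    (hopen.mem_nhds ⟨hz, hU⟩)
  rw [contDiffOn_clm_apply]
  intro e z hz
  exact (((hη.mono (V := U ⊓ chartDomain E x) inf_le_left).apply
    ((isHolField_coordField x e).mono inf_le_right)).contDiffAt hz.1
      ⟨hz.2, invChart_mem hz.1⟩).contDiffWithinAt

/-- The preferred trivialization of the tangent bundle is the differential of the chart. This links
the bundle definition of a holomorphic form with coordinate fields. -/
lemma symmL_trivializationAt_apply {x y : M} (hy : y ∈ chartDomain E x) (e : E) :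
    (trivializationAt E (TangentSpace 𝓘(ℂ, E)) x).symmL ℂ y e = coordField x e y := by
  have h1 : (trivializationAt E (TangentSpace 𝓘(ℂ, E)) x).continuousLinearMapAt ℂ y =
      chartDeriv x y := TangentBundle.continuousLinearMapAt_trivializationAt hy
  rw [← coordField_chartDeriv hy ((trivializationAt E (TangentSpace 𝓘(ℂ, E)) x).symmL ℂ y e), ← h1,
    Bundle.Trivialization.continuousLinearMapAt_symmL]
  exact hy

/-- In the trivialization over the chart the form becomes `pullForm`, and as `E` is
finite-dimensional, smoothness of a map into `E →L[ℂ] ℂ` can be tested on each vector. -/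
lemma isHolForm_iff_coordField {x : M} {U : Opens M} (hU : U ≤ chartDomain E x)
    {η : (x : M) → TangentSpace 𝓘(ℂ, E) x →L[ℂ] ℂ} :
    IsHolForm U η ↔ ∀ e : E, IsHolFun E U (fun y ↦ η y (coordField x e y)) := by
  have : CompleteSpace E := FiniteDimensional.complete ℂ E
  refine ⟨fun h e ↦ h.apply ((isHolField_coordField x e).mono hU), fun h ↦ ?_⟩
  have hbase : (U : Set M) ⊆ (trivializationAt (E →L[ℂ] ℂ)
      (fun x : M ↦ TangentSpace 𝓘(ℂ, E) x →L[ℂ] Bundle.Trivial M ℂ x) x).baseSet :=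
    fun y hy ↦ ⟨hU hy, Set.mem_univ _⟩
  rw [IsHolForm, Bundle.Trivialization.contMDiffOn_section_iff _ U.isOpen hbase]
  have hsm : ContMDiffOn 𝓘(ℂ, E) 𝓘(ℂ, E →L[ℂ] ℂ) ∞
      (fun y ↦ pullForm x η (extChartAt 𝓘(ℂ, E) x y)) U := by
    intro y hy
    have hopen : IsOpen (chartTarget E x ∩ invChart E x ⁻¹' U) :=
      ContinuousOn.isOpen_inter_preimage
        (fun z hz ↦ (continuousAt_invChart hz).continuousWithinAt) (isOpen_chartTarget x) U.isOpen
    have hmem : extChartAt 𝓘(ℂ, E) x y ∈ chartTarget E x ∩ invChart E x ⁻¹' U :=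
      ⟨chart_mem (hU hy), by rw [Set.mem_preimage, invChart_chart (hU hy)]; exact hy⟩
    have hc : ContDiffOn ℂ ∞ (pullForm x η) (chartTarget E x ∩ invChart E x ⁻¹' U) := by
      rw [contDiffOn_clm_apply]
      intro e z hz
      exact ((h e).contDiffAt hz.1 hz.2).contDiffWithinAt
    exact ((hc.contDiffAt (hopen.mem_nhds hmem)).contMDiffAt.comp y
      (contMDiffAt_extChartAt' (hU hy))).contMDiffWithinAt
  refine hsm.congr fun y hy ↦ ?_
  rw [hom_trivializationAt_apply]
  ext e
  -- The tangent space depends on the point, so the equality of base points is generalized before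
  -- substituting.
  have key : ∀ y', y' = y → η y' (coordField x e y') = η y (coordField x e y) := by
    rintro _ rfl; rfl
  rw [pullForm_apply, key _ (invChart_chart (hU hy)), ContinuousLinearMap.inCoordinates,
    ← symmL_trivializationAt_apply (hU hy)]
  exact congrArg (fun L : ℂ →L[ℂ] ℂ ↦
    L (η y ((trivializationAt E (TangentSpace 𝓘(ℂ, E)) x).symmL ℂ y e)))
    (Bundle.Trivial.continuousLinearMapAt_trivialization ℂ M ℂ y)

lemma IsHolFun.differential {U : Opens M} {f : M → ℂ} (hf : IsHolFun E U f) :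
    IsHolForm U (differential f : (x : M) → TangentSpace 𝓘(ℂ, E) x →L[ℂ] ℂ) := by
  refine .of_local fun x hx ↦ ⟨U ⊓ chartDomain E x, ⟨hx, mem_chart_source E x⟩, ?_⟩
  rw [isHolForm_iff_coordField inf_le_right]
  intro e
  refine (isHolFun_of_contDiffAt (x := x) (U := U ⊓ chartDomain E x)
    (g := fun z' ↦ fderiv ℂ (fun z ↦ f (invChart E x z)) z' e)
    inf_le_right fun y hy ↦ ?_).congr fun y hy ↦ hf.differential_coordField hy.2 hy.1 e
  refine ContDiffAt.clm_apply (ContDiffAt.fderiv_right (m := ∞) (n := ∞) ?_ le_rfl) contDiffAt_const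
  exact hf.contDiffAt (chart_mem hy.2) ((invChart_chart hy.2).symm ▸ hy.1)

/-- Chain rule for the chart composed with its inverse, which is the identity near `z`. -/
lemma mfderiv_invChart {x : M} {z : E} (hz : z ∈ chartTarget E x)
    {A : TangentSpace 𝓘(ℂ, E) (invChart E x z) ≃L[ℂ] E}
    (hA : (A : _ →L[ℂ] E) = chartDeriv x (invChart E x z)) :
    mfderiv 𝓘(ℂ, E) 𝓘(ℂ, E) (invChart E x) z = (A.symm : E →L[ℂ] _) := by
  have h1 := (hasMFDerivAt_chart (invChart_mem hz)).comp z
    ((contMDiffAt_invChart hz).mdifferentiableAt (by simp)).hasMFDerivAt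
  have h2 := h1.congr_of_eventuallyEq (f₁ := id) (by
    filter_upwards [(isOpen_chartTarget x).mem_nhds hz] with y hy
    exact (chart_invChart hy).symm)
  have h3 := h2.mfderiv
  rw [mfderiv_id] at h3
  ext e
  have := congrArg (fun L ↦ A.symm (L e)) h3
  rw [← hA] at this
  exact (A.symm_apply_apply _).symm.trans this.symm

lemma isInvertible_mfderiv_invChart {x : M} {z : E} (hz : z ∈ chartTarget E x) :
    (mfderiv 𝓘(ℂ, E) 𝓘(ℂ, E) (invChart E x) z).IsInvertible := by
  obtain ⟨A, hA⟩ := isInvertible_chartDeriv (invChart_mem hz)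
  exact ⟨A.symm, (mfderiv_invChart hz hA).symm⟩

lemma pullField_eq_mpullback {x : M} (v : (x : M) → TangentSpace 𝓘(ℂ, E) x) {z : E}
    (hz : z ∈ chartTarget E x) :
    pullField x v z = VectorField.mpullback 𝓘(ℂ, E) 𝓘(ℂ, E) (invChart E x) v z := by
  obtain ⟨A, hA⟩ := isInvertible_chartDeriv (invChart_mem hz)
  rw [pullField, VectorField.mpullback_apply, mfderiv_invChart hz hA, ← hA]
  exact (congrArg (fun L : TangentSpace 𝓘(ℂ, E) (invChart E x z) →L[ℂ] E ↦
    L (v (invChart E x z))) (ContinuousLinearMap.inverse_equiv A.symm)).symm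

lemma IsHolField.contDiffAt_pullField {U : Opens M} {v : (x : M) → TangentSpace 𝓘(ℂ, E) x}
    (hv : IsHolField U v) {x : M} {z : E} (hz : z ∈ chartTarget E x) (hU : invChart E x z ∈ U) :
    ContDiffAt ℂ ∞ (pullField x v) z := by
  have : CompleteSpace E := FiniteDimensional.complete ℂ E
  have h := ContMDiffAt.mpullback_vectorField_preimage (n := ∞) (hv.contMDiffAt hU)
    (contMDiffAt_invChart hz) (isInvertible_mfderiv_invChart hz) le_rfl
  refine (contMDiffAt_vectorSpace_iff_contDiffAt.1 h).congr_of_eventuallyEq ?_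
  filter_upwards [(isOpen_chartTarget x).mem_nhds hz] with y hy
  exact pullField_eq_mpullback v hy

lemma pullField_mlieBracket {U : Opens M} {v w : (x : M) → TangentSpace 𝓘(ℂ, E) x}
    (hv : IsHolField U v) (hw : IsHolField U w)
    {x : M} {z : E} (hz : z ∈ chartTarget E x) (hU : invChart E x z ∈ U) :
    pullField x (VectorField.mlieBracket 𝓘(ℂ, E) v w) z =
      VectorField.lieBracket ℂ (pullField x v) (pullField x w) z := by
  have : CompleteSpace E := FiniteDimensional.complete ℂ E
  have : IsManifold 𝓘(ℂ, E) (minSmoothness ℂ 3) M := by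
    simp only [minSmoothness_of_isRCLikeNormedField]; infer_instance
  rw [pullField_eq_mpullback _ hz, VectorField.mpullback_mlieBracket (n := ∞)
    ((hv.contMDiffAt hU).mdifferentiableAt (by simp))
    ((hw.contMDiffAt hU).mdifferentiableAt (by simp)) (contMDiffAt_invChart hz) (by
      simp only [minSmoothness_of_isRCLikeNormedField]; exact ENat.LEInfty.out),
    mlieBracket_eq_lieBracket]
  have h : ∀ u : (x : M) → TangentSpace 𝓘(ℂ, E) x,
      (VectorField.mpullback 𝓘(ℂ, E) 𝓘(ℂ, E) (invChart E x) u : E → E) =ᶠ[𝓝 z] pullField x u := by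
    intro u
    filter_upwards [(isOpen_chartTarget x).mem_nhds hz] with y hy
    exact (pullField_eq_mpullback u hy).symm
  exact Filter.EventuallyEq.lieBracket_vectorField_eq (h v) (h w)

lemma fieldDeriv_eq_differential (v : (x : M) → TangentSpace 𝓘(ℂ, E) x) (f : M → ℂ) (x : M) :
    fieldDeriv v f x = differential f x (v x) :=
  rfl

lemma IsHolFun.fieldDeriv_eq {U : Opens M} {f : M → ℂ} (hf : IsHolFun E U f)
    (v : (x : M) → TangentSpace 𝓘(ℂ, E) x) {x : M} {z : E} (hz : z ∈ chartTarget E x)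
    (hU : invChart E x z ∈ U) :
    fieldDeriv v f (invChart E x z) = fderiv ℂ (fun z ↦ f (invChart E x z)) z (pullField x v z) := by
  rw [fieldDeriv_eq_differential, hf.differential_eq (invChart_mem hz) hU, chart_invChart hz]
  rfl

lemma IsHolFun.fieldDeriv {U : Opens M} {f : M → ℂ} (hf : IsHolFun E U f)
    {v : (x : M) → TangentSpace 𝓘(ℂ, E) x} (hv : IsHolField U v) :
    IsHolFun E U (fieldDeriv v f) :=
  hf.differential.apply hv

/-- The value `dη(v, w)` of the exterior derivative of a 1-form on two vector fields,
given by Cartan's formula, computed in a chart. -/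
lemma IsHolForm.cartan {U : Opens M} {η : (x : M) → TangentSpace 𝓘(ℂ, E) x →L[ℂ] ℂ}
    (hη : IsHolForm U η) {v w : (x : M) → TangentSpace 𝓘(ℂ, E) x}
    (hv : IsHolField U v) (hw : IsHolField U w) {x : M} {z : E} (hz : z ∈ chartTarget E x)
    (hU : invChart E x z ∈ U) :
    _root_.fieldDeriv v (fun y ↦ η y (w y)) (invChart E x z) -
      _root_.fieldDeriv w (fun y ↦ η y (v y)) (invChart E x z) -
      η (invChart E x z) (VectorField.mlieBracket 𝓘(ℂ, E) v w (invChart E x z)) =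
    fderiv ℂ (pullForm x η) z (pullField x v z) (pullField x w z) -
      fderiv ℂ (pullForm x η) z (pullField x w z) (pullField x v z) := by
  have hη' := (hη.contDiffAt_pullForm hz hU).differentiableAt (by simp)
  -- Product rule for `η(u)` in the chart. After exchanging the two fields and subtracting, the
  -- terms with derivatives of the fields add up to `η` of the bracket.
  have key : ∀ {u u' : (x : M) → TangentSpace 𝓘(ℂ, E) x}, IsHolField U u →
      _root_.fieldDeriv u' (fun y ↦ η y (u y)) (invChart E x z) =
        fderiv ℂ (pullForm x η) z (pullField x u' z) (pullField x u z) +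
        pullForm x η z (fderiv ℂ (pullField x u) z (pullField x u' z)) := by
    intro u u' hu
    have hu1 := (hu.contDiffAt_pullField hz hU).differentiableAt (by simp)
    rw [(hη.apply hu).fieldDeriv_eq u' hz hU]
    have h1 : (fun z ↦ η (invChart E x z) (u (invChart E x z))) =ᶠ[𝓝 z]
        fun z ↦ pullForm x η z (pullField x u z) := by
      filter_upwards [(isOpen_chartTarget x).mem_nhds hz] with y hy
      exact (pullForm_pullField η u hy).symm
    rw [h1.fderiv_eq, fderiv_clm_apply hη' hu1]
    simp [add_comm]
  rw [key hw, key hv, ← pullForm_pullField η _ hz, pullField_mlieBracket hv hw hz hU,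
    VectorField.lieBracket, map_sub]
  ring

/-- In a chart this is the symmetry of the second derivative of `f`; it is the source of flatness
for the connection built from an affine structure. -/
lemma IsHolFun.fieldDeriv_mlieBracket {U : Opens M} {f : M → ℂ} (hf : IsHolFun E U f)
    {v w : (x : M) → TangentSpace 𝓘(ℂ, E) x} (hv : IsHolField U v) (hw : IsHolField U w)
    {x : M} (hx : x ∈ U) :
    _root_.fieldDeriv (VectorField.mlieBracket 𝓘(ℂ, E) v w) f x =
      _root_.fieldDeriv v (_root_.fieldDeriv w f) x -
        _root_.fieldDeriv w (_root_.fieldDeriv v f) x := by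
  obtain ⟨x, z, hz, rfl⟩ : ∃ x₀, ∃ z ∈ chartTarget E x₀, invChart E x₀ z = x :=
    ⟨x, _, chart_mem (mem_chart_source E x), invChart_chart (mem_chart_source E x)⟩
  have key : ∀ u : (x : M) → TangentSpace 𝓘(ℂ, E) x,
      (fun z ↦ _root_.fieldDeriv u f (invChart E x z)) =ᶠ[𝓝 z]
        fun z' ↦ fderiv ℂ (fun z ↦ f (invChart E x z)) z' (pullField x u z') := by
    intro u
    filter_upwards [(isOpen_chartTarget x).mem_nhds hz,
      (continuousAt_invChart hz).preimage_mem_nhds (U.isOpen.mem_nhds hx)] with y hy hyU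
    exact hf.fieldDeriv_eq u hy hyU
  rw [hf.fieldDeriv_eq _ hz hx, (hf.fieldDeriv hw).fieldDeriv_eq _ hz hx,
    (hf.fieldDeriv hv).fieldDeriv_eq _ hz hx, pullField_mlieBracket hv hw hz hx,
    (key v).fderiv_eq, (key w).fderiv_eq]
  refine VectorField.fderiv_apply_lieBracket (n := ∞) (hf.contDiffAt hz hx) ?_
    ((hw.contDiffAt_pullField hz hx).differentiableAt (by simp))
    ((hv.contDiffAt_pullField hz hx).differentiableAt (by simp))
  simp only [minSmoothness_of_isRCLikeNormedField]; exact ENat.LEInfty.out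

end ChartCalculus

/-! ### Chart balls and the Poincaré lemma. -/

section LocalTheory

open TopologicalSpace (Opens)

variable {E : Type u} [NormedAddCommGroup E] [NormedSpace ℂ E]
  {M : Type v} [TopologicalSpace M] [ChartedSpace E M] [IsManifold 𝓘(ℂ, E) ∞ M]

lemma IsHolField.smul {U : Opens M} {f : M → ℂ} {v : (x : M) → TangentSpace 𝓘(ℂ, E) x}
    (hf : IsHolFun E U f) (hv : IsHolField U v) : IsHolField U (fun x ↦ f x • v x) :=
  ContMDiffOn.smul_section hf hv

lemma IsHolForm.smul {U : Opens M} {f : M → ℂ} {η : (x : M) → TangentSpace 𝓘(ℂ, E) x →L[ℂ] ℂ}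
    (hf : IsHolFun E U f) (hη : IsHolForm U η) : IsHolForm U (fun x ↦ f x • η x) :=
  ContMDiffOn.smul_section hf hη

lemma isHolFun_const (U : Opens M) (c : ℂ) : IsHolFun E U (fun _ ↦ c) := contMDiffOn_const

lemma isHolField_zero (U : Opens M) :
    IsHolField U (fun x ↦ (0 : TangentSpace 𝓘(ℂ, E) x)) := by
  exact (Bundle.contMDiff_zeroSection ℂ (TangentSpace 𝓘(ℂ, E) (M := M))).contMDiffOn

lemma IsHolFun.mul {U : Opens M} {f g : M → ℂ} (hf : IsHolFun E U f) (hg : IsHolFun E U g) :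
    IsHolFun E U (fun x ↦ f x * g x) :=
  ContMDiffOn.mul hf hg

lemma IsHolFun.sub {U : Opens M} {f g : M → ℂ} (hf : IsHolFun E U f) (hg : IsHolFun E U g) :
    IsHolFun E U (fun x ↦ f x - g x) :=
  ContMDiffOn.sub hf hg

lemma IsHolFun.cexp_neg {U : Opens M} {f : M → ℂ} (hf : IsHolFun E U f) :
    IsHolFun E U (fun x ↦ Complex.exp (- f x)) :=
  ContMDiff.comp_contMDiffOn (I' := 𝓘(ℂ, ℂ)) (g := fun z ↦ Complex.exp (-z))
    (Complex.contDiff_exp.comp contDiff_neg).contMDiff hf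

lemma differential_cexp_neg {U : Opens M} {f : M → ℂ} (hf : IsHolFun E U f) {x : M} (hx : x ∈ U) :
    (differential (fun x ↦ Complex.exp (- f x)) x : TangentSpace 𝓘(ℂ, E) x →L[ℂ] ℂ) =
      (- Complex.exp (- f x)) • differential f x := by
  have h : HasDerivAt (fun z : ℂ ↦ Complex.exp (-z)) (- Complex.exp (- f x)) (f x) := by
    simpa using (hasDerivAt_neg (f x)).cexp
  have := (h.hasFDerivAt.hasMFDerivAt.comp x (hf.mdifferentiableAt hx).hasMFDerivAt).mfderiv
  refine this.trans ?_
  ext w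
  change differential f x w * _ = _ * differential f x w
  ring

lemma differential_mul {U : Opens M} {f g : M → ℂ} (hf : IsHolFun E U f) (hg : IsHolFun E U g)
    {x : M} (hx : x ∈ U) : (differential (fun x ↦ f x * g x) x : TangentSpace 𝓘(ℂ, E) x →L[ℂ] ℂ) =
      f x • differential g x + g x • differential f x := by
  exact ((hf.mdifferentiableAt hx).hasMFDerivAt.mul (hg.mdifferentiableAt hx).hasMFDerivAt).mfderiv

lemma differential_sub {U : Opens M} {f g : M → ℂ} (hf : IsHolFun E U f) (hg : IsHolFun E U g)
    {x : M} (hx : x ∈ U) : (differential (fun x ↦ f x - g x) x : TangentSpace 𝓘(ℂ, E) x →L[ℂ] ℂ) =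
      differential f x - differential g x := by
  exact ((hf.mdifferentiableAt hx).hasMFDerivAt.sub (hg.mdifferentiableAt hx).hasMFDerivAt).mfderiv

lemma differential_const (c : ℂ) (x : M) :
    (differential (fun _ ↦ c) x : TangentSpace 𝓘(ℂ, E) x →L[ℂ] ℂ) = 0 :=
  mfderiv_const

/-- The ball of radius `r` in the preferred chart at `x`. -/
def chartBall (E : Type u) [NormedAddCommGroup E] [NormedSpace ℂ E] {M : Type v} [TopologicalSpace M]
    [ChartedSpace E M] (x : M) (r : ℝ) : Opens M :=
  ⟨_, (continuousOn_extChartAt (I := 𝓘(ℂ, E)) x).isOpen_inter_preimage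
    (isOpen_extChartAt_source x) (Metric.isOpen_ball (x := extChartAt 𝓘(ℂ, E) x x) (ε := r))⟩

lemma mem_chartBall {x y : M} {r : ℝ} : y ∈ chartBall E x r ↔
    y ∈ chartDomain E x ∧ extChartAt 𝓘(ℂ, E) x y ∈ Metric.ball (extChartAt 𝓘(ℂ, E) x x) r := by
  change _ ∈ (extChartAt 𝓘(ℂ, E) x).source ∩ _ ↔ _
  rw [extChartAt_source]
  rfl

lemma exists_chartBall_le {x : M} {U : Opens M} (hx : x ∈ U) : ∃ r > 0,
    Metric.ball (extChartAt 𝓘(ℂ, E) x x) r ⊆ chartTarget E x ∧ chartBall E x r ≤ U := by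
  have h1 := (isOpen_chartTarget x).mem_nhds (chart_mem (mem_chart_source E x))
  have h2 := (continuousAt_invChart (chart_mem (mem_chart_source E x))).preimage_mem_nhds
    (U.isOpen.mem_nhds (by rw [invChart_chart (mem_chart_source E x)]; exact hx))
  obtain ⟨r, hr, h⟩ := Metric.mem_nhds_iff.1 (Filter.inter_mem h1 h2)
  refine ⟨r, hr, fun z hz ↦ (h hz).1, fun y hy ↦ ?_⟩
  have hy := mem_chartBall.1 hy
  have := (h hy.2).2
  rwa [Set.mem_preimage, invChart_chart hy.1] at this

lemma self_mem_chartBall {x : M} {r : ℝ} (hr : 0 < r) : x ∈ chartBall E x r :=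
  mem_chartBall.2 ⟨mem_chart_source E x, Metric.mem_ball_self hr⟩

/-- By `hr` the set is the continuous image of a full convex ball; otherwise only the part of the
ball inside the chart's image would count. -/
lemma isPreconnected_chartBall {x : M} {r : ℝ}
    (hr : Metric.ball (extChartAt 𝓘(ℂ, E) x x) r ⊆ chartTarget E x) :
    IsPreconnected (chartBall E x r : Set M) := by
  let _ : NormedSpace ℝ E := NormedSpace.restrictScalars ℝ ℂ E
  have h : (chartBall E x r : Set M) =
      invChart E x '' Metric.ball (extChartAt 𝓘(ℂ, E) x x) r := by
    ext y
    refine ⟨fun hy ↦ ⟨_, (mem_chartBall.1 hy).2, invChart_chart (mem_chartBall.1 hy).1⟩, ?_⟩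
    rintro ⟨z, hz, rfl⟩
    exact mem_chartBall.2 ⟨invChart_mem (hr hz), by rwa [chart_invChart (hr hz)]⟩
  rw [h]
  exact (convex_ball _ _).isPreconnected.image _
    fun z hz ↦ (continuousAt_invChart (hr hz)).continuousWithinAt

variable [FiniteDimensional ℂ E]

lemma fieldDeriv_coordField {U : Opens M} {f : M → ℂ} (hf : IsHolFun E U f) {x : M} {z : E}
    (hz : z ∈ chartTarget E x) (hU : invChart E x z ∈ U) (e : E) :
    fieldDeriv (coordField x e) f (invChart E x z) = fderiv ℂ (fun z ↦ f (invChart E x z)) z e := by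
  rw [hf.fieldDeriv_eq _ hz hU, pullField, chartDeriv_coordField (invChart_mem hz)]

/-- Since coordinate fields commute, symmetry of this expression in `a` and `b` is closedness of
`η`. -/
lemma IsHolForm.fderiv_pullForm_apply {x : M} {U : Opens M} (hU : U ≤ chartDomain E x)
    {η : (x : M) → TangentSpace 𝓘(ℂ, E) x →L[ℂ] ℂ} (hη : IsHolForm U η) {z : E}
    (hz : z ∈ chartTarget E x) (hzU : invChart E x z ∈ U) (a b : E) :
    fderiv ℂ (pullForm x η) z a b =
      fieldDeriv (coordField x a) (fun y ↦ η y (coordField x b y)) (invChart E x z) := by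
  have hd : DifferentiableAt ℂ (pullForm x η) z :=
    (hη.contDiffAt_pullForm hz hzU).differentiableAt (by simp)
  rw [fieldDeriv_coordField ((isHolForm_iff_coordField hU).1 hη b) hz hzU]
  have : (fun z ↦ η (invChart E x z) (coordField x b (invChart E x z))) =
    fun z ↦ pullForm x η z b := rfl
  rw [this, fderiv_clm_apply hd (differentiableAt_const b)]
  simp

/-- Poincaré lemma for 1-forms on a ball in a chart. -/
lemma IsHolForm.exists_primitive {x : M} {r : ℝ}
    (hr : Metric.ball (extChartAt 𝓘(ℂ, E) x x) r ⊆ chartTarget E x)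
    {η : (x : M) → TangentSpace 𝓘(ℂ, E) x →L[ℂ] ℂ} (hη : IsHolForm (chartBall E x r) η)
    (hclosed : ∀ y ∈ chartBall E x r, ∀ a b : E,
      fieldDeriv (coordField x a) (fun y ↦ η y (coordField x b y)) y =
        fieldDeriv (coordField x b) (fun y ↦ η y (coordField x a y)) y) :
    ∃ f : M → ℂ, IsHolFun E (chartBall E x r) f ∧
      ∀ y ∈ chartBall E x r, differential f y = η y := by
  let _ : NormedSpace ℝ E := NormedSpace.restrictScalars ℝ ℂ E
  have : CompleteSpace E := FiniteDimensional.complete ℂ E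
  have hmem : ∀ z ∈ Metric.ball (extChartAt 𝓘(ℂ, E) x x) r, invChart E x z ∈ chartBall E x r :=
    fun z hz ↦ mem_chartBall.2 ⟨invChart_mem (hr hz), by rwa [chart_invChart (hr hz)]⟩
  have hle : chartBall E x r ≤ chartDomain E x := fun y hy ↦ (mem_chartBall.1 hy).1
  have hsm : ∀ z ∈ Metric.ball (extChartAt 𝓘(ℂ, E) x x) r, ContDiffAt ℂ ∞ (pullForm x η) z :=
    fun z hz ↦ hη.contDiffAt_pullForm (hr hz) (hmem z hz)
  have hd : ∀ z ∈ Metric.ball (extChartAt 𝓘(ℂ, E) x x) r, DifferentiableAt ℂ (pullForm x η) z :=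
    fun z hz ↦ (hsm z hz).differentiableAt (by simp)
  -- The Poincaré lemma on a convex set is applied with the real derivative of the form. The
  -- primitive is still complex differentiable, because the form takes complex-linear values.
  have hclosed' : ∀ z ∈ Metric.ball (extChartAt 𝓘(ℂ, E) x x) r, ∀ a b : E,
      fderiv ℝ (pullForm x η) z a b = fderiv ℝ (pullForm x η) z b a := by
    intro z hz a b
    rw [(hd z hz).fderiv_restrictScalars ℝ]
    change fderiv ℂ (pullForm x η) z a b = fderiv ℂ (pullForm x η) z b a
    rw [hη.fderiv_pullForm_apply hle (hr hz) (hmem z hz),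
      hη.fderiv_pullForm_apply hle (hr hz) (hmem z hz), hclosed _ (hmem z hz)]
  have hdiff : DifferentiableOn ℝ (pullForm x η) (Metric.ball (extChartAt 𝓘(ℂ, E) x x) r) :=
    fun z hz ↦ ((hd z hz).restrictScalars ℝ).differentiableWithinAt
  obtain ⟨g, hg⟩ := (convex_ball (extChartAt 𝓘(ℂ, E) x x) r).exists_forall_hasFDerivAt_of_fderiv_symmetric
    Metric.isOpen_ball hdiff hclosed'
  have hgs : ContDiffOn ℂ ∞ g (Metric.ball (extChartAt 𝓘(ℂ, E) x x) r) := by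
    rw [contDiffOn_infty_iff_fderiv_of_isOpen Metric.isOpen_ball]
    refine ⟨fun z hz ↦ (hg z hz).differentiableAt.differentiableWithinAt, ?_⟩
    exact ContDiffOn.congr (fun z hz ↦ (hsm z hz).contDiffWithinAt) fun z hz ↦ (hg z hz).fderiv
  refine ⟨fun y ↦ g (extChartAt 𝓘(ℂ, E) x y), isHolFun_of_contDiffAt hle fun y hy ↦ ?_, fun y hy ↦ ?_⟩
  · have hy' := (mem_chartBall.1 hy).2
    exact hgs.contDiffAt (Metric.isOpen_ball.mem_nhds hy')
  · have hy' := mem_chartBall.1 hy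
    rw [differential_comp_chart hy'.1 (hg _ hy'.2)]
    ext w
    rw [ContinuousLinearMap.comp_apply]
    have h1 := pullForm_pullField η (fun y' ↦ coordField x (chartDeriv x y w) y') (chart_mem hy'.1)
    rw [pullField, chartDeriv_coordField (invChart_mem (chart_mem hy'.1))] at h1
    rw [h1]
    have key : ∀ y', y' = y → η y' (coordField x (chartDeriv x y w) y') = η y w := by
      rintro _ rfl; rw [coordField_chartDeriv hy'.1]
    exact key _ (invChart_chart hy'.1)

end LocalTheory

/-! ### Conormal frames and ratios of conormal forms. -/

namespace CodimOneFoliation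

open TopologicalSpace (Opens)

variable {E : Type u} [NormedAddCommGroup E] [NormedSpace ℂ E]
  {M : Type v} [TopologicalSpace M] [ChartedSpace E M] [IsManifold 𝓘(ℂ, E) ∞ M]

/-- A conormal form which does not vanish at any point of `U`. -/
def IsConormalFrame (F : CodimOneFoliation E M) (U : Opens M)
    (η : (x : M) → TangentSpace 𝓘(ℂ, E) x →L[ℂ] ℂ) : Prop :=
  IsHolForm U η ∧ ∀ x ∈ U, η x ≠ 0 ∧ ∀ w, η x w = 0 ↔ w ∈ F.tangent x

variable {F : CodimOneFoliation E M} {U V : Opens M}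
  {η θ : (x : M) → TangentSpace 𝓘(ℂ, E) x →L[ℂ] ℂ}
  {v w : (x : M) → TangentSpace 𝓘(ℂ, E) x}

lemma IsConormalFrame.isConormal (h : F.IsConormalFrame U η) : F.IsConormal U η :=
  ⟨h.1, fun x hx w hw ↦ ((h.2 x hx).2 w).2 hw⟩

lemma IsConormalFrame.mono (h : F.IsConormalFrame U η) (hV : V ≤ U) : F.IsConormalFrame V η :=
  ⟨h.1.mono hV, fun x hx ↦ h.2 x (hV hx)⟩

lemma IsConormal.mono (h : F.IsConormal U η) (hV : V ≤ U) : F.IsConormal V η :=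
  ⟨h.1.mono hV, fun x hx ↦ h.2 x (hV hx)⟩

lemma IsConormal.congr (h : F.IsConormal U η) (h' : ∀ x ∈ U, θ x = η x) : F.IsConormal U θ :=
  ⟨h.1.congr h', fun x hx w hw ↦ by rw [h' x hx, h.2 x hx w hw]⟩

lemma IsConormal.smul {f : M → ℂ} (hf : IsHolFun E U f) (h : F.IsConormal U η) :
    F.IsConormal U (fun x ↦ f x • η x) :=
  ⟨.smul hf h.1, fun x hx w hw ↦ by
    rw [smul_apply, h.2 x hx w hw, smul_zero]⟩

/-- The ratio of a conormal form by a frame, `0` where the form is not a multiple of the frame. -/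
noncomputable def ratio (η θ : (x : M) → TangentSpace 𝓘(ℂ, E) x →L[ℂ] ℂ) (x : M) : ℂ := by
  classical exact if h : ∃ c : ℂ, θ x = c • η x then h.choose else 0

/-- Every `w` differs from `(β w / β u) • u` by an element of the kernel of `β`. -/
lemma eq_smul_of_ker {W : Type*} [AddCommGroup W] [Module ℂ W] [TopologicalSpace W]
    {α β : W →L[ℂ] ℂ} (h : ∀ w, β w = 0 → α w = 0) {u : W} (hu : β u ≠ 0) :
    α = (α u / β u) • β := by
  ext w
  have h1 := h (w - (β w / β u) • u) (by simp [hu])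
  rw [map_sub, map_smul, sub_eq_zero] at h1
  rw [h1, smul_apply, smul_eq_mul, smul_eq_mul]
  ring

lemma ratio_eq {x : M} (hη : η x ≠ 0) {c : ℂ} (h : θ x = c • η x) : ratio η θ x = c := by
  have h' : ∃ c : ℂ, θ x = c • η x := ⟨c, h⟩
  rw [ratio, dif_pos h']
  exact smul_left_injective ℂ hη (h'.choose_spec.symm.trans h)

lemma IsConormalFrame.ratio_smul (hη : F.IsConormalFrame U η) (hθ : F.IsConormal U θ) {x : M}
    (hx : x ∈ U) : θ x = ratio η θ x • η x := by
  obtain ⟨u, hu⟩ := DFunLike.ne_iff.1 (hη.2 x hx).1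
  have h := eq_smul_of_ker (fun w hw ↦ hθ.2 x hx w (((hη.2 x hx).2 w).1 hw)) hu
  rw [ratio_eq (hη.2 x hx).1 h]
  exact h

lemma IsConormalFrame.ratio_eq_div (hη : F.IsConormalFrame U η) (hθ : F.IsConormal U θ) {x : M}
    (hx : x ∈ U) {u : TangentSpace 𝓘(ℂ, E) x} (hu : η x u ≠ 0) :
    ratio η θ x = θ x u / η x u := by
  have := congrArg (· u) (hη.ratio_smul hθ hx)
  simp only [smul_apply, smul_eq_mul] at this
  rw [this, mul_div_cancel_right₀ _ hu]

/-- Near each point the ratio is a quotient of values on one coordinate field, chosen so that the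
frame does not vanish on it there. -/
lemma IsConormalFrame.isHolFun_ratio [FiniteDimensional ℂ E]
    (hη : F.IsConormalFrame U η) (hθ : F.IsConormal U θ) :
    IsHolFun E U (ratio η θ) := by
  have : CompleteSpace E := FiniteDimensional.complete ℂ E
  intro x hx
  obtain ⟨u, hu⟩ := DFunLike.ne_iff.1 (hη.2 x hx).1
  have hx' : x ∈ chartDomain E x := mem_chart_source E x
  set e := chartDeriv x x u
  have he : η x (coordField x e x) ≠ 0 := by rwa [coordField_chartDeriv hx']
  have h1 : IsHolFun E (U ⊓ chartDomain E x) (fun y ↦ η y (coordField x e y)) :=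
    (hη.1.mono inf_le_left).apply ((isHolField_coordField x e).mono inf_le_right)
  have h2 : IsHolFun E (U ⊓ chartDomain E x) (fun y ↦ θ y (coordField x e y)) :=
    (hθ.1.mono inf_le_left).apply ((isHolField_coordField x e).mono inf_le_right)
  have h3 := (h2.contMDiffAt ⟨hx, hx'⟩).div₀ (h1.contMDiffAt ⟨hx, hx'⟩) he
  refine (h3.congr_of_eventuallyEq ?_).contMDiffWithinAt
  filter_upwards [U.isOpen.mem_nhds hx,
    (h1.contMDiffAt ⟨hx, hx'⟩).continuousAt.eventually_ne he] with y hy hy'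
  exact hη.ratio_eq_div hθ hy hy'

/-- A combination of the local frame with constant coefficients. It lets the Bott condition, which
concerns fields, be used on single tangent vectors. -/
lemma exists_isTangentField {x : M} {c : TangentSpace 𝓘(ℂ, E) x} (hc : c ∈ F.tangent x) :
    ∃ (W : Opens M) (v : (x : M) → TangentSpace 𝓘(ℂ, E) x),
      x ∈ W ∧ F.IsTangentField W v ∧ v x = c := by
  obtain ⟨W, hxW, d, v, hv, hspan⟩ := F.exists_frame x
  rw [← (hspan x hxW).2, Submodule.mem_span_range_iff_exists_fun] at hc
  obtain ⟨a, ha⟩ := hc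
  refine ⟨W, fun y ↦ ∑ i, a i • v i y, hxW, ⟨?_, fun y hy ↦ ?_⟩, ha⟩
  · exact ContMDiffOn.sum_section fun i _ ↦ IsHolField.smul (isHolFun_const W (a i)) (hv i)
  · rw [← (hspan y hy).2]
    exact Submodule.sum_mem _ fun i _ ↦ Submodule.smul_mem _ _ (Submodule.subset_span ⟨i, rfl⟩)

/-- The linear map `(c, t) ↦ ∑ i, c i • v i + t • e`. -/
noncomputable def frameMap {d : ℕ} (v : Fin d → E) (e : E) : ((Fin d → ℂ) × ℂ) →L[ℂ] E :=
  (∑ i, ((ContinuousLinearMap.proj i).comp (ContinuousLinearMap.fst ℂ (Fin d → ℂ) ℂ)).smulRight (v i)) +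
    (ContinuousLinearMap.snd ℂ (Fin d → ℂ) ℂ).smulRight e

lemma frameMap_apply {d : ℕ} (v : Fin d → E) (e : E) (p : (Fin d → ℂ) × ℂ) :
    frameMap v e p = ∑ i, p.1 i • v i + p.2 • e := by
  simp [frameMap]

/-- Complete the local frame of the foliation by a coordinate field transverse to it at `x`. The
result is still a frame of the tangent bundle near `x`, and the component along the added field is
the required form. -/
lemma exists_isConormalFrame [FiniteDimensional ℂ E] (F : CodimOneFoliation E M) (x : M) :
    ∃ (U : Opens M) (η : (x : M) → TangentSpace 𝓘(ℂ, E) x →L[ℂ] ℂ),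
      x ∈ U ∧ F.IsConormalFrame U η := by
  have : CompleteSpace E := FiniteDimensional.complete ℂ E
  have hx' : x ∈ chartDomain E x := mem_chart_source E x
  obtain ⟨U, hxU, d, v, hv, hspan⟩ := F.exists_frame x
  set Φ := extChartAt 𝓘(ℂ, E) x
  have hne : F.tangent x ≠ ⊤ := by
    intro h
    have := F.codim_one x
    rw [h] at this
    simp [Module.finrank_zero_of_subsingleton] at this
  obtain ⟨w, hw⟩ : ∃ w, w ∉ F.tangent x := by
    by_contra! h
    exact hne ((Submodule.eq_top_iff').2 h)
  set e := chartDeriv x x w with he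
  -- the frame in coordinates
  set L : E → ((Fin d → ℂ) × ℂ) →L[ℂ] E := fun z ↦ frameMap (fun i ↦ pullField x (v i) z) e with hL
  have hLsm : ∀ y ∈ U ⊓ chartDomain E x, ContDiffAt ℂ ∞ L (Φ y) := by
    intro y hy
    have h : ∀ i, ContDiffAt ℂ ∞ (pullField x (v i)) (Φ y) := fun i ↦
      (hv i).contDiffAt_pullField (chart_mem hy.2) ((invChart_chart hy.2).symm ▸ hy.1)
    refine ContDiffAt.add (ContDiffAt.sum fun i _ ↦ ?_) contDiffAt_const
    exact contDiffAt_const.smulRight (h i)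
  have hLy : ∀ y ∈ chartDomain E x, L (Φ y) = frameMap (fun i ↦ chartDeriv x y (v i y)) e := by
    intro y hy
    have : ∀ i, pullField x (v i) (Φ y) = chartDeriv x y (v i y) := fun i ↦ by
      have key : ∀ y', y' = y → chartDeriv x y' (v i y') = chartDeriv x y (v i y) := by
        rintro _ rfl; rfl
      exact key _ (invChart_chart hy)
    simp only [hL, this]
  -- Injectivity uses independence of the frame and `w ∉ F.tangent x`; surjectivity uses that the
  -- quotient by `F.tangent x` is spanned by the class of `w`.
  have hinv : (L (Φ x)).IsInvertible := by
    refine ⟨ContinuousLinearEquiv.ofBijective (L (Φ x)) (LinearMap.ker_eq_bot'.2 ?_)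
      (LinearMap.range_eq_top.2 ?_), ContinuousLinearEquiv.coe_ofBijective ..⟩
    · intro p hp
      change L (Φ x) p = 0 at hp
      rw [hLy x hx', frameMap_apply] at hp
      have h0 : ∑ i, p.1 i • v i x + p.2 • w = 0 := by
        obtain ⟨A, hA⟩ := isInvertible_chartDeriv hx'
        apply A.injective
        have : ∀ u, A u = chartDeriv x x u := fun u ↦ by rw [← hA]; rfl
        rw [this, map_add, map_sum, map_smul, map_zero]
        simpa only [map_smul] using hp
      have hs : ∑ i, p.1 i • v i x ∈ F.tangent x := by
        rw [← (hspan x hxU).2]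
        exact Submodule.sum_mem _ fun i _ ↦ Submodule.smul_mem _ _ (Submodule.subset_span ⟨i, rfl⟩)
      have h2 : p.2 = 0 := by
        by_contra h2
        refine hw ((Submodule.smul_mem_iff _ h2).1 ?_)
        rw [← neg_eq_of_add_eq_zero_right h0]
        exact Submodule.neg_mem _ hs
      rw [h2, zero_smul, add_zero] at h0
      have h1 := Fintype.linearIndependent_iff.1 (hspan x hxU).1 _ h0
      exact Prod.ext (funext h1) h2
    · intro a
      obtain ⟨α, hα⟩ : ∃ c : ℂ, ∃ u ∈ F.tangent x, coordField x a x = u + c • w := by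
        have hwq : (Submodule.Quotient.mk w : TangentSpace 𝓘(ℂ, E) x ⧸ F.tangent x) ≠ 0 := by
          rwa [Ne, Submodule.Quotient.mk_eq_zero]
        obtain ⟨c, hc⟩ := (finrank_eq_one_iff_of_nonzero' _ hwq).1 (F.codim_one x)
          (Submodule.Quotient.mk (coordField x a x))
        refine ⟨c, coordField x a x - c • w, ?_, by abel⟩
        rw [← Submodule.Quotient.mk_eq_zero, Submodule.Quotient.mk_sub, Submodule.Quotient.mk_smul,
          hc, sub_self]
      obtain ⟨u, hu, hα⟩ := hα
      rw [← (hspan x hxU).2, Submodule.mem_span_range_iff_exists_fun] at hu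
      obtain ⟨c, rfl⟩ := hu
      refine ⟨(c, α), ?_⟩
      change L (Φ x) (c, α) = a
      rw [hLy x hx', frameMap_apply, ← chartDeriv_coordField hx' a, hα, map_add, map_sum, map_smul]
      simp only [map_smul, he]
  set R : Set (((Fin d → ℂ) × ℂ) →L[ℂ] E) := {A | A.IsInvertible} with hR
  have hRo : IsOpen R := by
    have : R = Set.range ((↑) : (((Fin d → ℂ) × ℂ) ≃L[ℂ] E) → ((Fin d → ℂ) × ℂ) →L[ℂ] E) := rfl
    rw [this]
    exact ContinuousLinearEquiv.isOpen
  have hLΦ : ∀ y ∈ U ⊓ chartDomain E x, ContinuousAt (fun y ↦ L (Φ y)) y := fun y hy ↦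
    (hLsm y hy).continuousAt.comp (f := Φ) (continuousAt_extChartAt' (by rw [extChartAt_source]; exact hy.2))
  have hVo : IsOpen ((U ⊓ chartDomain E x : Opens M) ∩ (fun y ↦ L (Φ y)) ⁻¹' R : Set M) :=
    ContinuousOn.isOpen_inter_preimage (fun y hy ↦ (hLΦ y hy).continuousWithinAt)
      (U ⊓ chartDomain E x).isOpen hRo
  set V : Opens M := ⟨_, hVo⟩
  have hVle : V ≤ chartDomain E x := fun y hy ↦ hy.1.2
  refine ⟨V, fun y ↦ ((ContinuousLinearMap.snd ℂ (Fin d → ℂ) ℂ).comp (L (Φ y)).inverse).comp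
    (chartDeriv x y), ⟨⟨hxU, hx'⟩, hinv⟩, ?_, ?_⟩
  · rw [isHolForm_iff_coordField hVle]
    intro a
    refine (isHolFun_of_contDiffAt hVle (g := fun z ↦ ((L z).inverse a).2) fun y hy ↦ ?_).congr
      fun y hy ↦ ?_
    · obtain ⟨B, hB⟩ := hy.2
      have h1 : ContDiffAt ℂ ∞ (fun z ↦ (L z).inverse) (Φ y) :=
        ContDiffAt.comp (f := L) (g := ContinuousLinearMap.inverse) (Φ y) (by
          have h := contDiffAt_map_inverse (n := ∞) B
          rwa [show (B : _ →L[ℂ] E) = L (Φ y) from hB] at h) (hLsm y hy.1)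
      exact contDiff_snd.contDiffAt.comp _ (h1.clm_apply contDiffAt_const)
    · simp only [ContinuousLinearMap.comp_apply, chartDeriv_coordField (hVle hy)]
      rfl
  · rintro y ⟨hy, B, hB⟩
    have hBy : ∀ p, B p = ∑ i, p.1 i • chartDeriv x y (v i y) + p.2 • e := by
      intro p
      rw [← frameMap_apply, ← hLy y hy.2]
      exact congrArg (· p) hB
    have hη : ∀ u, (((ContinuousLinearMap.snd ℂ (Fin d → ℂ) ℂ).comp (L (Φ y)).inverse).comp
        (chartDeriv x y)) u = (B.symm (chartDeriv x y u)).2 := by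
      intro u
      change ((L (Φ y)).inverse (chartDeriv x y u)).2 = _
      rw [show L (Φ y) = B from hB.symm, ContinuousLinearMap.inverse_equiv]
      rfl
    refine ⟨fun h ↦ ?_, fun u ↦ ?_⟩
    -- The form takes the value `1` on the added field, since `e` is the image of `(0, 1)`.
    · have h1 : (0 : ℂ) = _ := (congrArg (· (coordField x e y)) h).symm.trans (hη (coordField x e y))
      rw [chartDeriv_coordField hy.2, show e = B (0, 1) by simp [hBy], B.symm_apply_apply] at h1
      exact zero_ne_one h1
    · rw [hη, ← (hspan y hy.1).2]
      constructor
      · intro hu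
        set p := B.symm (chartDeriv x y u)
        have h1 : chartDeriv x y u = chartDeriv x y (∑ i, p.1 i • v i y) := by
          rw [← B.apply_symm_apply (chartDeriv x y u), hBy, map_sum]
          simp only [map_smul]
          change _ + p.2 • e = _
          rw [hu, zero_smul, add_zero]
        rw [← coordField_chartDeriv hy.2 u, h1, coordField_chartDeriv hy.2]
        exact Submodule.sum_mem _ fun i _ ↦ Submodule.smul_mem _ _ (Submodule.subset_span ⟨i, rfl⟩)
      · intro hu
        rw [Submodule.mem_span_range_iff_exists_fun] at hu
        obtain ⟨c, rfl⟩ := hu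
        have : chartDeriv x y (∑ i, c i • v i y) = B (c, 0) := by
          rw [hBy, map_sum]
          simp only [map_smul, zero_smul, add_zero]
        rw [this, B.symm_apply_apply]

end CodimOneFoliation

/-! ### From a transversely affine structure to a flat connection. -/

namespace CodimOneFoliation

open TopologicalSpace (Opens)

variable {E : Type u} [NormedAddCommGroup E] [NormedSpace ℂ E]
  {M : Type v} [TopologicalSpace M] [ChartedSpace E M] [IsManifold 𝓘(ℂ, E) ∞ M]
  [FiniteDimensional ℂ E]

lemma add_smul_form {W : Type*} [AddCommGroup W] [Module ℂ W] [TopologicalSpace W]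
    (a b : ℂ) (α : W →L[ℂ] ℂ) : (a + b) • α = a • α + b • α := by
  ext w; exact add_mul _ _ _

lemma sub_smul_form {W : Type*} [AddCommGroup W] [Module ℂ W] [TopologicalSpace W]
    (a b : ℂ) (α : W →L[ℂ] ℂ) : (a - b) • α = a • α - b • α := by
  ext w; exact sub_mul _ _ _

lemma _root_.fieldDeriv_congr {v w : (x : M) → TangentSpace 𝓘(ℂ, E) x} {f g : M → ℂ} {x : M}
    (hv : v x = w x) (h : f =ᶠ[𝓝 x] g) : fieldDeriv v f x = fieldDeriv w g x := by
  rw [fieldDeriv_eq_differential, fieldDeriv_eq_differential, differential_congr h, hv]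

lemma _root_.fieldDeriv_const (v : (x : M) → TangentSpace 𝓘(ℂ, E) x) (c : ℂ) (x : M) :
    fieldDeriv v (fun _ ↦ c) x = 0 := by
  rw [fieldDeriv_eq_differential, differential_const]; rfl

lemma _root_.IsHolFun.fieldDeriv_mul {U : Opens M} {f g : M → ℂ} (hf : IsHolFun E U f)
    (hg : IsHolFun E U g) (v : (x : M) → TangentSpace 𝓘(ℂ, E) x) {x : M} (hx : x ∈ U) :
    fieldDeriv v (fun x ↦ f x * g x) x = f x * fieldDeriv v g x + g x * fieldDeriv v f x := by
  rw [fieldDeriv_eq_differential, differential_mul hf hg hx]; rfl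

lemma _root_.IsHolFun.fieldDeriv_add {U : Opens M} {f g : M → ℂ} (hf : IsHolFun E U f)
    (hg : IsHolFun E U g) (v : (x : M) → TangentSpace 𝓘(ℂ, E) x) {x : M} (hx : x ∈ U) :
    fieldDeriv v (fun x ↦ f x + g x) x = fieldDeriv v f x + fieldDeriv v g x := by
  have := ((hf.mdifferentiableAt hx).hasMFDerivAt.add (hg.mdifferentiableAt hx).hasMFDerivAt).mfderiv
  exact congrArg (fun L : TangentSpace 𝓘(ℂ, E) x →L[ℂ] ℂ ↦ L (v x)) this

lemma isConormalFrame_differential {F : CodimOneFoliation E M} {U : Opens M} {f : M → ℂ}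
    (hf : IsHolFun E U f)
    (hsub : ∀ x ∈ U, Function.Surjective (mfderiv 𝓘(ℂ, E) 𝓘(ℂ, ℂ) f x))
    (hker : ∀ x ∈ U, ∀ w : TangentSpace 𝓘(ℂ, E) x,
      mfderiv 𝓘(ℂ, E) 𝓘(ℂ, ℂ) f x w = 0 ↔ w ∈ F.tangent x) :
    F.IsConormalFrame U (differential f) := by
  refine ⟨hf.differential, fun x hx ↦ ⟨fun h ↦ ?_, hker x hx⟩⟩
  obtain ⟨w, hw⟩ := hsub x hx (1 : ℂ)
  exact zero_ne_one ((congrArg (· w) h).symm.trans hw)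

namespace TransverselyAffineStructure

variable {F : CodimOneFoliation E M} (S : F.TransverselyAffineStructure)

lemma isConormalFrame (i : S.ι) : F.IsConormalFrame (S.U i) (differential (S.φ i)) :=
  isConormalFrame_differential (S.holomorphic i) (S.submersion i) (S.ker_eq i)

/-- The index of a distinguished submersion defined near `x`. -/
noncomputable def index (x : M) : S.ι := (S.covers x).choose

lemma mem_index (x : M) : x ∈ S.U (S.index x) := (S.covers x).choose_spec

/-- The connection for which the differentials of the distinguished submersions are parallel. -/
noncomputable def parallelCov (v : (x : M) → TangentSpace 𝓘(ℂ, E) x)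
    (η : (x : M) → TangentSpace 𝓘(ℂ, E) x →L[ℂ] ℂ) (x : M) : TangentSpace 𝓘(ℂ, E) x →L[ℂ] ℂ :=
  fieldDeriv v (ratio (differential (S.φ (S.index x))) η) x • differential (S.φ (S.index x)) x

variable {U : Opens M} {η θ : (x : M) → TangentSpace 𝓘(ℂ, E) x →L[ℂ] ℂ}
  {v w : (x : M) → TangentSpace 𝓘(ℂ, E) x}

lemma differential_eq_smul (i j : S.ι) : ∃ a : ℂ, a ≠ 0 ∧ ∀ x ∈ S.U i ⊓ S.U j,
    (differential (S.φ i) x : TangentSpace 𝓘(ℂ, E) x →L[ℂ] ℂ) = a • differential (S.φ j) x := by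
  obtain ⟨a, b, ha, h⟩ := S.affine i j
  refine ⟨a, ha, fun x hx ↦ ?_⟩
  have h1 : S.φ i =ᶠ[𝓝 x] fun y ↦ a * S.φ j y + b :=
    Filter.eventually_of_mem ((S.U i ⊓ S.U j).isOpen.mem_nhds hx) h
  rw [differential_congr h1]
  exact ((((S.holomorphic j).mdifferentiableAt hx.2).hasMFDerivAt.const_smul a).add
    (hasMFDerivAt_const b x)).mfderiv.trans (add_zero _)

/-- Changing the submersion multiplies the ratio by a constant, which passes through the derivative
and is absorbed by the change of frame. Since `index x` varies arbitrarily with `x`, this is needed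
to fix one index on a neighbourhood. -/
lemma parallelCov_eq (hη : F.IsConormal U η) (v : (x : M) → TangentSpace 𝓘(ℂ, E) x) {x : M}
    (hx : x ∈ U) {j : S.ι} (hj : x ∈ S.U j) :
    S.parallelCov v η x = fieldDeriv v (ratio (differential (S.φ j)) η) x • differential (S.φ j) x := by
  set i := S.index x
  have hi : x ∈ S.U i := S.mem_index x
  obtain ⟨a, ha, h⟩ := S.differential_eq_smul i j
  have h1 : ratio (differential (S.φ j)) η =ᶠ[𝓝 x]
      fun y ↦ a * ratio (differential (S.φ i)) η y := by
    filter_upwards [U.isOpen.mem_nhds hx, (S.U i).isOpen.mem_nhds hi, (S.U j).isOpen.mem_nhds hj]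
      with y hy hyi hyj
    apply ratio_eq ((S.isConormalFrame j).2 y hyj).1
    rw [((S.isConormalFrame i).mono (V := U ⊓ S.U i) inf_le_right).ratio_smul
      (hη.mono inf_le_left) ⟨hy, hyi⟩]
    rw [h y ⟨hyi, hyj⟩, smul_smul, mul_comm]
  have h2 : IsHolFun E (U ⊓ S.U i) (ratio (differential (S.φ i)) η) :=
    ((S.isConormalFrame i).mono inf_le_right).isHolFun_ratio (hη.mono inf_le_left)
  rw [fieldDeriv_congr rfl h1, (isHolFun_const _ a).fieldDeriv_mul h2 v ⟨hx, hi⟩, fieldDeriv_const,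
    mul_zero, add_zero, parallelCov, h x ⟨hi, hj⟩, smul_smul, mul_comm]

lemma isHolFun_ratio (hη : F.IsConormal U η) (j : S.ι) :
    IsHolFun E (U ⊓ S.U j) (ratio (differential (S.φ j)) η) :=
  ((S.isConormalFrame j).mono inf_le_right).isHolFun_ratio (hη.mono inf_le_left)

lemma eq_ratio_smul (hη : F.IsConormal U η) {j : S.ι} {x : M} (hx : x ∈ U) (hj : x ∈ S.U j) :
    η x = ratio (differential (S.φ j)) η x • differential (S.φ j) x :=
  ((S.isConormalFrame j).mono (V := U ⊓ S.U j) inf_le_right).ratio_smul (hη.mono inf_le_left) ⟨hx, hj⟩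

lemma ratio_parallelCov (hη : F.IsConormal U η) (v : (x : M) → TangentSpace 𝓘(ℂ, E) x) {x : M}
    (hx : x ∈ U) {j : S.ι} (hj : x ∈ S.U j) :
    ratio (differential (S.φ j)) (S.parallelCov v η) x =
      fieldDeriv v (ratio (differential (S.φ j)) η) x :=
  ratio_eq ((S.isConormalFrame j).2 x hj).1 (S.parallelCov_eq hη v hx hj)

lemma isConormal_parallelCov (hv : IsHolField U v) (hη : F.IsConormal U η) :
    F.IsConormal U (S.parallelCov v η) := by
  refine ⟨.of_local fun x hx ↦ ⟨U ⊓ S.U (S.index x), ⟨hx, S.mem_index x⟩, ?_⟩, fun x hx w hw ↦ ?_⟩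
  · refine (IsHolForm.smul ((S.isHolFun_ratio hη _).fieldDeriv (hv.mono inf_le_left))
      ((S.isConormalFrame (S.index x)).1.mono inf_le_right)).congr fun y hy ↦ ?_
    exact S.parallelCov_eq hη v hy.1 hy.2
  · rw [parallelCov, smul_apply, (S.isConormalFrame _).isConormal.2 x (S.mem_index x) w hw,
      smul_zero]

lemma parallelCov_congr (hη : ∀ x ∈ U, η x = θ x) (hv : ∀ x ∈ U, v x = w x) {x : M} (hx : x ∈ U) :
    S.parallelCov v η x = S.parallelCov w θ x := by
  rw [parallelCov, parallelCov, fieldDeriv_congr (hv x hx)]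
  filter_upwards [U.isOpen.mem_nhds hx] with y hy
  rw [ratio, ratio, hη y hy]

lemma parallelCov_leibniz {f : M → ℂ} (hf : IsHolFun E U f)
    (hη : F.IsConormal U η) {x : M} (hx : x ∈ U) :
    S.parallelCov v (fun y ↦ f y • η y) x = fieldDeriv v f x • η x + f x • S.parallelCov v η x := by
  have h : ratio (differential (S.φ (S.index x))) (fun y ↦ f y • η y) =ᶠ[𝓝 x]
      fun y ↦ f y * ratio (differential (S.φ (S.index x))) η y := by
    filter_upwards [U.isOpen.mem_nhds hx, (S.U _).isOpen.mem_nhds (S.mem_index x)] with y hy hyi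
    apply ratio_eq ((S.isConormalFrame _).2 y hyi).1
    rw [mul_smul, ← S.eq_ratio_smul hη hy hyi]
  rw [parallelCov, fieldDeriv_congr rfl h,
    (hf.mono inf_le_left).fieldDeriv_mul (S.isHolFun_ratio hη _) v ⟨hx, S.mem_index x⟩,
    S.eq_ratio_smul hη hx (S.mem_index x), parallelCov, add_smul_form, mul_smul, mul_comm, mul_smul, add_comm]

lemma parallelCov_add (hη : F.IsConormal U η) (hθ : F.IsConormal U θ) {x : M} (hx : x ∈ U) :
    S.parallelCov v (fun y ↦ η y + θ y) x = S.parallelCov v η x + S.parallelCov v θ x := by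
  have h : ratio (differential (S.φ (S.index x))) (fun y ↦ η y + θ y) =ᶠ[𝓝 x]
      fun y ↦ ratio (differential (S.φ (S.index x))) η y +
        ratio (differential (S.φ (S.index x))) θ y := by
    filter_upwards [U.isOpen.mem_nhds hx, (S.U _).isOpen.mem_nhds (S.mem_index x)] with y hy hyi
    apply ratio_eq ((S.isConormalFrame _).2 y hyi).1
    rw [add_smul_form, ← S.eq_ratio_smul hη hy hyi, ← S.eq_ratio_smul hθ hy hyi]
  rw [parallelCov, fieldDeriv_congr rfl h,
    (S.isHolFun_ratio hη _).fieldDeriv_add (S.isHolFun_ratio hθ _) v ⟨hx, S.mem_index x⟩, add_smul_form]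
  rfl

/-- The connection on the conormal sheaf defined by a transversely affine structure. -/
noncomputable def connection : F.ConormalConnection where
  cov _ v η := S.parallelCov v η
  isConormal _ _ _ hv hη := S.isConormal_parallelCov hv hη
  restrict _ _ _ _ _ _ _ _ _ _ _ hvv hηη _ hx := S.parallelCov_congr hηη hvv hx
  add_field _ v w η _ _ _ x _ := by
    simp only [parallelCov, fieldDeriv_eq_differential, map_add, add_smul_form]
  smul_field _ f v η _ _ _ x _ := by
    simp only [parallelCov, fieldDeriv_eq_differential, map_smul, smul_eq_mul, mul_smul]
  add_form _ _ _ _ _ hη hθ _ hx := S.parallelCov_add hη hθ hx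
  leibniz _ _ _ _ hf _ hη _ hx := S.parallelCov_leibniz hf hη hx

/-- In a distinguished frame, covariant differentiation is differentiation of the coefficient, so
the curvature identity is that of functions. -/
lemma isFlat_connection : S.connection.IsFlat := by
  intro U v w η hv hw hη x hx
  change S.parallelCov _ η x = S.parallelCov v (S.parallelCov w η) x -
    S.parallelCov w (S.parallelCov v η) x
  have hi := S.mem_index x
  set i := S.index x
  have h (u : (x : M) → TangentSpace 𝓘(ℂ, E) x) :
      ratio (differential (S.φ i)) (S.parallelCov u η) =ᶠ[𝓝 x]
        fieldDeriv u (ratio (differential (S.φ i)) η) := by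
    filter_upwards [U.isOpen.mem_nhds hx, (S.U i).isOpen.mem_nhds hi] with y hy hyi
    exact S.ratio_parallelCov hη u hy hyi
  rw [S.parallelCov_eq hη _ hx hi, S.parallelCov_eq (S.isConormal_parallelCov hw hη) _ hx hi,
    S.parallelCov_eq (S.isConormal_parallelCov hv hη) _ hx hi, fieldDeriv_congr rfl (h w),
    fieldDeriv_congr rfl (h v), (S.isHolFun_ratio hη i).fieldDeriv_mlieBracket
      (hv.mono inf_le_left) (hw.mono inf_le_left) ⟨hx, hi⟩, sub_smul_form]

/-- With `η = g dφ` and `v(φ) = 0`, one has `[v, w](φ) = v(w(φ))`. Hence `v(g w(φ)) - g [v, w](φ)`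
reduces to `v(g) w(φ)`. -/
lemma extendsBott_connection : S.connection.ExtendsBott := by
  intro U v η w hv hη hw x hx
  change S.parallelCov v η x (w x) = _
  have hi := S.mem_index x
  set i := S.index x
  set g := ratio (differential (S.φ i)) η
  have hg := S.isHolFun_ratio hη i
  have hφ : IsHolFun E (U ⊓ S.U i) (S.φ i) := (S.holomorphic i).mono inf_le_right
  have hv' := hv.1.mono (V := U ⊓ S.U i) inf_le_left
  have hw' := hw.mono (V := U ⊓ S.U i) inf_le_left
  have hxi : x ∈ U ⊓ S.U i := ⟨hx, hi⟩
  have h : (fun y ↦ η y (w y)) =ᶠ[𝓝 x] fun y ↦ g y * fieldDeriv w (S.φ i) y := by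
    filter_upwards [U.isOpen.mem_nhds hx, (S.U i).isOpen.mem_nhds hi] with y hy hyi
    rw [S.eq_ratio_smul hη hy hyi]
    rfl
  have h0 : fieldDeriv v (S.φ i) =ᶠ[𝓝 x] fun _ ↦ 0 := by
    filter_upwards [U.isOpen.mem_nhds hx, (S.U i).isOpen.mem_nhds hi] with y hy hyi
    exact (S.isConormalFrame i).isConormal.2 y hyi _ (hv.2 y hy)
  have h1 := hφ.fieldDeriv_mlieBracket hv' hw' hxi
  rw [fieldDeriv_congr (w := w) rfl h0, fieldDeriv_const, sub_zero] at h1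
  rw [lieDerivForm, fieldDeriv_congr rfl h, hg.fieldDeriv_mul (hφ.fieldDeriv hw') v hxi,
    S.eq_ratio_smul hη hx hi, smul_apply, ← fieldDeriv_eq_differential, h1, S.parallelCov_eq hη v hx hi,
    smul_apply, ← fieldDeriv_eq_differential]
  simp only [smul_eq_mul]
  ring

end TransverselyAffineStructure

end CodimOneFoliation

/-! ### Star refinement of a neighbourhood assignment. -/

/-- Take a locally finite refinement `u` and shrink it to a cover `k` with `closure (k i) ⊆ u i`.
Let `W x` lie in every `u i` with `x ∈ closure (k i)` and avoid all the other closures. If a common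
point of `W x` and `W y` lies in `k i`, then `x` and `y` lie in `closure (k i)`, so both sets lie in
`u i`. -/
lemma exists_star_refinement {X : Type*} [TopologicalSpace X] [T2Space X] [ParacompactSpace X]
    (V : X → Set X) (hV : ∀ x, IsOpen (V x)) (hxV : ∀ x, x ∈ V x) :
    ∃ W : X → Set X, (∀ x, W x ∈ 𝓝 x) ∧
      ∀ x y, (W x ∩ W y).Nonempty → ∃ z, W x ⊆ V z ∧ W y ⊆ V z := by
  obtain ⟨u, huo, hu, hlf, huV⟩ := precise_refinement V hV
    (Set.iUnion_eq_univ_iff.2 fun x ↦ ⟨x, hxV x⟩)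
  obtain ⟨k, hk, -, hku⟩ := exists_iUnion_eq_closure_subset huo hlf.point_finite hu
  have hklf : LocallyFinite fun i ↦ closure (k i) := hlf.subset hku
  refine ⟨fun x ↦ (⋂ i ∈ {i | x ∈ closure (k i)}, u i) ∩
    ⋂ (i) (_ : x ∉ closure (k i)), (closure (k i))ᶜ, fun x ↦ Filter.inter_mem ?_ ?_, ?_⟩
  · exact (Filter.biInter_mem (hklf.point_finite x)).2 fun i hi ↦ (huo i).mem_nhds (hku i hi)
  · exact hklf.iInter_compl_mem_nhds (fun _ ↦ isClosed_closure) x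
  · rintro x y ⟨z, hzx, hzy⟩
    obtain ⟨i, hi⟩ := Set.iUnion_eq_univ_iff.1 hk z
    have hmem : ∀ x, z ∈ ⋂ (i) (_ : x ∉ closure (k i)), (closure (k i))ᶜ → x ∈ closure (k i) := by
      intro x hz
      by_contra hx
      exact Set.mem_iInter₂.1 hz i hx (subset_closure hi)
    exact ⟨i, fun a ha ↦ huV i (Set.mem_iInter₂.1 ha.1 i (hmem x hzx.2)),
      fun a ha ↦ huV i (Set.mem_iInter₂.1 ha.1 i (hmem y hzy.2))⟩

/-! ### From a flat connection to a transversely affine structure. -/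

namespace CodimOneFoliation

open TopologicalSpace (Opens)

variable {E : Type u} [NormedAddCommGroup E] [NormedSpace ℂ E]
  {M : Type v} [TopologicalSpace M] [ChartedSpace E M] [IsManifold 𝓘(ℂ, E) ∞ M]
  [FiniteDimensional ℂ E]

lemma zero_smul_form {W : Type*} [AddCommGroup W] [Module ℂ W] [TopologicalSpace W]
    (α : W →L[ℂ] ℂ) : (0 : ℂ) • α = 0 := by
  ext w; exact zero_mul _

lemma smul_zero_form {W : Type*} [AddCommGroup W] [Module ℂ W] [TopologicalSpace W]
    (c : ℂ) : c • (0 : W →L[ℂ] ℂ) = 0 := by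
  ext w; exact mul_zero _

lemma sum_smul_form {W : Type*} [AddCommGroup W] [Module ℂ W] [TopologicalSpace W]
    {ι : Type*} (s : Finset ι) (c : ι → ℂ) (α : W →L[ℂ] ℂ) :
    (∑ i ∈ s, c i) • α = ∑ i ∈ s, c i • α := by
  ext w
  simp [Finset.sum_mul]

lemma surjective_of_ne_zero {W : Type*} [AddCommGroup W] [Module ℂ W] [TopologicalSpace W]
    {α : W →L[ℂ] ℂ} (h : α ≠ 0) : Function.Surjective α :=
  LinearMap.surjective (f := (α : W →ₗ[ℂ] ℂ)) fun h' ↦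
    h (ContinuousLinearMap.coe_injective h')

lemma _root_.chartBall_le (x : M) (r : ℝ) : chartBall E x r ≤ chartDomain E x :=
  fun _ hy ↦ (mem_chartBall.1 hy).1

/-- The function is constant on chart balls, and preconnectedness propagates the equality. -/
lemma _root_.IsHolFun.eq_of_differential_eq_zero {U : Opens M} {f : M → ℂ} (hf : IsHolFun E U f)
    (hU : IsPreconnected (U : Set M))
    (h0 : ∀ x ∈ U, (differential f x : TangentSpace 𝓘(ℂ, E) x →L[ℂ] ℂ) = 0) {x y : M} (hx : x ∈ U)
    (hy : y ∈ U) : f x = f y := by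
  let _ : NormedSpace ℝ E := NormedSpace.restrictScalars ℝ ℂ E
  refine hU.induction₂ (fun x y ↦ f x = f y) (fun x hx ↦ ?_) (fun _ _ _ _ _ _ ↦ Eq.trans)
    (fun _ _ _ _ ↦ Eq.symm) hx hy
  obtain ⟨r, hr, hball, hle⟩ := exists_chartBall_le (E := E) hx
  apply mem_nhdsWithin_of_mem_nhds
  filter_upwards [(chartBall E x r).isOpen.mem_nhds (self_mem_chartBall hr)] with y hy
  have hmem : ∀ z ∈ Metric.ball (extChartAt 𝓘(ℂ, E) x x) r, invChart E x z ∈ U :=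
    fun z hz ↦ hle (mem_chartBall.2 ⟨invChart_mem (hball hz), by rwa [chart_invChart (hball hz)]⟩)
  have := Metric.isOpen_ball.is_const_of_fderiv_eq_zero (𝕜 := ℂ)
    (f := fun z ↦ f (invChart E x z)) (convex_ball (extChartAt 𝓘(ℂ, E) x x) r).isPreconnected
    (fun z hz ↦ ((hf.contDiffAt (hball hz) (hmem z hz)).differentiableAt
      (by simp)).differentiableWithinAt) (fun z hz ↦ by
        ext e
        rw [← fieldDeriv_coordField hf (hball hz) (hmem z hz), fieldDeriv_eq_differential,
          h0 _ (hmem z hz)]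
        rfl) (Metric.mem_ball_self hr) (mem_chartBall.1 hy).2
  simpa only [invChart_chart (mem_chart_source E x : x ∈ chartDomain E x),
    invChart_chart (mem_chartBall.1 hy).1] using this

lemma _root_.IsHolField.exists_sum_coordField {U : Opens M}
    {v : (x : M) → TangentSpace 𝓘(ℂ, E) x} (hv : IsHolField U v) {x : M} (hU : U ≤ chartDomain E x) :
    ∃ f : Fin (Module.finrank ℂ E) → M → ℂ, (∀ i, IsHolFun E U (f i)) ∧
      ∀ y ∈ U, v y = ∑ i, f i y • coordField x (Module.finBasis ℂ E i) y := by
  set b := Module.finBasis ℂ E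
  refine ⟨fun i y ↦ b.coord i (pullField x v (extChartAt 𝓘(ℂ, E) x y)), fun i ↦ ?_, fun y hy ↦ ?_⟩
  · refine isHolFun_of_contDiffAt hU (g := fun z ↦ b.coord i (pullField x v z)) fun y hy ↦ ?_
    exact (LinearMap.toContinuousLinearMap (b.coord i)).contDiff.contDiffAt.comp _
      (hv.contDiffAt_pullField (chart_mem (hU hy)) ((invChart_chart (hU hy)).symm ▸ hy))
  · have h : pullField x v (extChartAt 𝓘(ℂ, E) x y) = chartDeriv x y (v y) := by
      have key : ∀ y', y' = y → chartDeriv x y' (v y') = chartDeriv x y (v y) := by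
        rintro _ rfl; rfl
      exact key _ (invChart_chart (hU hy))
    calc v y = coordField x (chartDeriv x y (v y)) y := (coordField_chartDeriv (hU hy) _).symm
      _ = coordField x (∑ i, b.repr (chartDeriv x y (v y)) i • b i) y := by rw [b.sum_repr]
      _ = _ := by simp only [h, coordField_apply, map_sum, map_smul, Module.Basis.coord_apply]

namespace ConormalConnection

variable {F : CodimOneFoliation E M} (C : F.ConormalConnection) {U V : Opens M}
  {η θ : (x : M) → TangentSpace 𝓘(ℂ, E) x →L[ℂ] ℂ} {v w : (x : M) → TangentSpace 𝓘(ℂ, E) x}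

lemma cov_congr (hv : IsHolField U v) (hη : F.IsConormal U η) (hvw : ∀ x ∈ U, w x = v x)
    (hηθ : ∀ x ∈ U, θ x = η x) {x : M} (hx : x ∈ U) : C.cov U v η x = C.cov U w θ x :=
  C.restrict U U v w η θ le_rfl hv hη (hv.congr hvw) (hη.congr hηθ) (fun x hx ↦ (hvw x hx).symm)
    (fun x hx ↦ (hηθ x hx).symm) x hx

lemma cov_mono (hVU : V ≤ U) (hv : IsHolField U v) (hη : F.IsConormal U η) {x : M} (hx : x ∈ V) :
    C.cov V v η x = C.cov U v η x :=
  (C.restrict U V v v η η hVU hv hη (hv.mono hVU) (hη.mono hVU) (fun _ _ ↦ rfl) (fun _ _ ↦ rfl)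
    x hx).symm

lemma cov_zero (hη : F.IsConormal U η) {x : M} (hx : x ∈ U) :
    C.cov U (fun _ ↦ 0) η x = 0 := by
  -- The zero field is the zero function times itself.
  have h := C.smul_field U (fun _ ↦ 0) (fun _ ↦ 0) η (isHolFun_const U 0) (isHolField_zero U) hη x hx
  rw [← C.cov_congr (isHolField_zero U) hη (fun _ _ ↦ smul_zero _) (fun _ _ ↦ rfl) hx] at h
  rw [h, zero_smul_form]

lemma cov_sum {ι : Type*} (s : Finset ι) {f : ι → M → ℂ}
    {v : ι → (x : M) → TangentSpace 𝓘(ℂ, E) x} (hf : ∀ i, IsHolFun E U (f i))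
    (hv : ∀ i, IsHolField U (v i)) (hη : F.IsConormal U η) {x : M} (hx : x ∈ U) :
    C.cov U (fun y ↦ ∑ i ∈ s, f i y • v i y) η x = ∑ i ∈ s, f i x • C.cov U (v i) η x := by
  classical
  induction s using Finset.induction_on with
  | empty => simpa using C.cov_zero hη hx
  | insert i s hi ih =>
    simp only [Finset.sum_insert hi]
    rw [C.add_field U _ _ η (.smul (hf i) (hv i))
      (ContMDiffOn.sum_section fun i _ ↦ IsHolField.smul (hf i) (hv i)) hη x hx,
      C.smul_field U _ _ η (hf i) (hv i) hη x hx, ih]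

/-- The conormal form `η` is parallel over `U`. -/
def IsParallel (U : Opens M) (η : (x : M) → TangentSpace 𝓘(ℂ, E) x →L[ℂ] ℂ) : Prop :=
  ∀ V ≤ U, ∀ v, IsHolField V v → ∀ x ∈ V, C.cov V v η x = 0

variable {C}

lemma IsParallel.mono (h : C.IsParallel U η) (hVU : V ≤ U) : C.IsParallel V η :=
  fun W hW ↦ h W (hW.trans hVU)

lemma IsParallel.congr (h : C.IsParallel U η) (hη : F.IsConormal U η) (hηθ : ∀ x ∈ U, θ x = η x) :
    C.IsParallel U θ := fun V hV v hv x hx ↦ by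
  rw [← C.cov_congr hv (hη.mono hV) (fun _ _ ↦ rfl) (fun x hx ↦ hηθ x (hV hx)) hx, h V hV v hv x hx]

/-- The connection is linear over functions in the field, and coordinate fields generate all fields
in the chart. -/
lemma isParallel_of_coordField {x : M} (hU : U ≤ chartDomain E x) (hη : F.IsConormal U η)
    (h : ∀ e : E, ∀ y ∈ U, C.cov U (coordField x e) η y = 0) : C.IsParallel U η := by
  have : CompleteSpace E := FiniteDimensional.complete ℂ E
  intro V hV v hv y hy
  obtain ⟨f, hf, hvf⟩ := hv.exists_sum_coordField (hV.trans hU)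
  rw [C.cov_congr hv (hη.mono hV) (fun x hx ↦ (hvf x hx).symm) (fun _ _ ↦ rfl) hy,
    C.cov_sum _ hf (fun i ↦ (isHolField_coordField x _).mono (hV.trans hU)) (hη.mono hV) hy]
  refine Finset.sum_eq_zero fun i _ ↦ ?_
  rw [C.cov_mono hV ((isHolField_coordField x _).mono hU) hη hy, h _ y (hV hy), smul_zero_form]

lemma IsParallel.closed (hC : C.ExtendsBott) {x : M} (hU : U ≤ chartDomain E x)
    (hη : F.IsConormalFrame U η) (h : C.IsParallel U η) {y : M} (hy : y ∈ U) (a b : E) :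
    fieldDeriv (coordField x a) (fun y ↦ η y (coordField x b y)) y =
      fieldDeriv (coordField x b) (fun y ↦ η y (coordField x a y)) y := by
  have : CompleteSpace E := FiniteDimensional.complete ℂ E
  obtain ⟨z, hz, rfl⟩ : ∃ z ∈ chartTarget E x, invChart E x z = y :=
    ⟨_, chart_mem (hU hy), invChart_chart (hU hy)⟩
  rw [← hη.1.fderiv_pullForm_apply hU hz hy, ← hη.1.fderiv_pullForm_apply hU hz hy]
  set D := fderiv ℂ (pullForm x η) z
  set y := invChart E x z
  -- In Cartan's formula for `dη(v, w)` with `v` tangent, `w(η(v))` vanishes and the rest is `ℒ_v η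
  -- (w) = (∇_v η)(w) = 0`.
  have key : ∀ c ∈ F.tangent y, ∀ e, D (chartDeriv x y c) e = D e (chartDeriv x y c) := by
    intro c hc e
    obtain ⟨W, v, hyW, hv, rfl⟩ := exists_isTangentField hc
    have hle : W ⊓ U ≤ U := inf_le_right
    have hyWU : y ∈ W ⊓ U := ⟨hyW, hy⟩
    have hv1 : IsHolField (W ⊓ U) v := hv.1.mono inf_le_left
    have hw : IsHolField (W ⊓ U) (coordField x e) := (isHolField_coordField x e).mono (hle.trans hU)
    have h1 := (hη.1.mono hle).cartan hv1 hw hz hyWU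
    have h2 := hC (W ⊓ U) v η (coordField x e) ⟨hv1, fun y hy ↦ hv.2 y hy.1⟩
      (hη.isConormal.mono hle) hw y hyWU
    rw [h _ hle v hv1 y hyWU, lieDerivForm] at h2
    have h3 : fieldDeriv (coordField x e) (fun y ↦ η y (v y)) y = 0 := by
      have h4 : (fun y ↦ η y (v y)) =ᶠ[𝓝 y] fun _ ↦ 0 := by
        filter_upwards [(W ⊓ U).isOpen.mem_nhds hyWU] with y hy
        exact hη.isConormal.2 y hy.2 _ (hv.2 y hy.1)
      rw [fieldDeriv_congr rfl h4, fieldDeriv_const]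
    have h5 : pullField x (coordField x e) z = e := chartDeriv_coordField (invChart_mem hz) e
    rw [h3, sub_zero, ← h2, h5] at h1
    exact sub_eq_zero.1 h1.symm
  obtain ⟨u, hu⟩ := DFunLike.ne_iff.1 (hη.2 y hy).1
  -- Modulo tangent vectors only multiples of `u` remain, and on a pair of these `D` is trivially
  -- symmetric.
  have hdec : ∀ e : E, ∃ c ∈ F.tangent y, ∃ t : ℂ, e = chartDeriv x y c + t • chartDeriv x y u := by
    intro e
    refine ⟨coordField x e y - (η y (coordField x e y) / η y u) • u,
      ((hη.2 y hy).2 _).1 ?_, η y (coordField x e y) / η y u, ?_⟩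
    · rw [map_sub, map_smul, smul_eq_mul, div_mul_cancel₀ _ hu, sub_self]
    · rw [map_sub, map_smul, sub_add_cancel, chartDeriv_coordField (hU hy)]
  obtain ⟨c, hc, t, rfl⟩ := hdec a
  obtain ⟨c', hc', t', rfl⟩ := hdec b
  simp only [map_add, map_smul, add_apply, smul_apply]
  simp only [smul_eq_mul]
  linear_combination key c hc (chartDeriv x y c') + t' * key c hc (chartDeriv x y u) -
    t * key c' hc' (chartDeriv x y u)

/-- The connection form of a flat connection on a line bundle is closed; a primitive `h` of it
rescales any frame to a parallel one. -/
lemma exists_isParallel (hC : C.IsFlat) (x : M) : ∃ (r : ℝ)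
    (η : (x : M) → TangentSpace 𝓘(ℂ, E) x →L[ℂ] ℂ), 0 < r ∧
      Metric.ball (extChartAt 𝓘(ℂ, E) x x) r ⊆ chartTarget E x ∧
      F.IsConormalFrame (chartBall E x r) η ∧ C.IsParallel (chartBall E x r) η := by
  have : CompleteSpace E := FiniteDimensional.complete ℂ E
  obtain ⟨U, η, hxU, hη⟩ := F.exists_isConormalFrame x
  obtain ⟨r, hr, hball, hle⟩ := exists_chartBall_le (E := E) hxU
  set B := chartBall E x r
  replace hη : F.IsConormalFrame B η := hη.mono hle
  have hB : B ≤ chartDomain E x := chartBall_le x r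
  have hcoord : ∀ e, IsHolField B (coordField x e) := fun e ↦ (isHolField_coordField x e).mono hB
  set b := Module.finBasis ℂ E
  -- the connection form
  set T : Fin (Module.finrank ℂ E) → M → ℂ := fun i ↦ ratio η (C.cov B (coordField x (b i)) η)
  have hcov : ∀ e, F.IsConormal B (C.cov B (coordField x e) η) := fun e ↦
    C.isConormal B _ η (hcoord e) hη.isConormal
  have hT : ∀ i, IsHolFun E B (T i) := fun i ↦ hη.isHolFun_ratio (hcov (b i))
  set θ : (x : M) → TangentSpace 𝓘(ℂ, E) x →L[ℂ] ℂ := fun y ↦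
    ∑ i, T i y • (LinearMap.toContinuousLinearMap (b.coord i)).comp (chartDeriv x y) with hθ
  have hθe : ∀ e, ∀ y ∈ B, θ y (coordField x e y) = ∑ i, b.coord i e * T i y := by
    intro e y hy
    simp only [hθ, sum_apply, smul_apply, ContinuousLinearMap.comp_apply,
      chartDeriv_coordField (hB hy), smul_eq_mul, mul_comm (T _ y)]
    rfl
  have hθcov : ∀ e, ∀ y ∈ B, C.cov B (coordField x e) η y = θ y (coordField x e y) • η y := by
    intro e y hy
    have h1 : ∀ y ∈ B, ∑ i, b.coord i e • coordField x (b i) y = coordField x e y := by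
      intro y hy
      conv_rhs => rw [← b.sum_repr e]
      simp only [coordField_apply, map_sum, map_smul, Module.Basis.coord_apply]
    rw [C.cov_congr (hcoord e) hη.isConormal h1 (fun _ _ ↦ rfl) hy,
      C.cov_sum _ (fun i ↦ isHolFun_const B (b.coord i e)) (fun i ↦ hcoord (b i)) hη.isConormal hy,
      hθe e y hy, sum_smul_form]
    refine Finset.sum_congr rfl fun i _ ↦ ?_
    rw [hη.ratio_smul (hcov (b i)) hy, smul_smul]
  have hθhol : ∀ e, IsHolFun E B (fun y ↦ θ y (coordField x e y)) := by
    intro e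
    refine IsHolFun.congr ?_ (hθe e)
    exact contMDiffOn_finsetSum fun i _ ↦ (isHolFun_const B (b.coord i e)).mul (hT i)
  have hθform : IsHolForm B θ := (isHolForm_iff_coordField hB).2 hθhol
  -- Coordinate fields commute, so flatness equates the two iterated derivatives of `η`. Their
  -- quadratic terms in `θ` cancel, leaving closedness of `θ`.
  obtain ⟨h, hh, hdh⟩ := hθform.exists_primitive hball (fun y hy a c ↦ by
    have h1 := hC B (coordField x a) (coordField x c) η (hcoord a) (hcoord c) hη.isConormal y hy
    have h2 : ∀ a c : E, C.cov B (coordField x a) (C.cov B (coordField x c) η) y =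
        (fieldDeriv (coordField x a) (fun y ↦ θ y (coordField x c y)) y +
          θ y (coordField x c y) * θ y (coordField x a y)) • η y := by
      intro a c
      rw [C.cov_congr (hcoord a) (hcov c) (fun _ _ ↦ rfl) (fun y hy ↦ (hθcov c y hy).symm) hy,
        C.leibniz B _ _ _ (hθhol c) (hcoord a) hη.isConormal y hy, hθcov a y hy, add_smul_form,
        mul_smul]
    rw [h2, h2, ← C.cov_congr (isHolField_zero B) hη.isConormal
      (fun y hy ↦ mlieBracket_coordField (hB hy) a c) (fun _ _ ↦ rfl) hy, C.cov_zero hη.isConormal hy,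
      ← sub_smul_form] at h1
    have h3 := (smul_eq_zero.1 h1.symm).resolve_right (hη.2 y hy).1
    linear_combination h3)
  -- The factor solves `dg = -g θ`, so the Leibniz term cancels the connection form.
  refine ⟨r, fun y ↦ Complex.exp (- h y) • η y, hr, hball, ⟨.smul hh.cexp_neg hη.1, fun y hy ↦ ?_⟩, ?_⟩
  · refine ⟨smul_ne_zero (Complex.exp_ne_zero _) (hη.2 y hy).1, fun w ↦ ?_⟩
    rw [← (hη.2 y hy).2, smul_apply, smul_eq_mul, mul_eq_zero, or_iff_right (Complex.exp_ne_zero _)]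
  · refine isParallel_of_coordField hB (.smul hh.cexp_neg hη.isConormal) fun e y hy ↦ ?_
    rw [C.leibniz B _ _ _ hh.cexp_neg (hcoord e) hη.isConormal y hy, fieldDeriv_eq_differential,
      differential_cexp_neg hh hy, hθcov e y hy, hdh y hy, smul_apply, smul_smul, ← add_smul_form]
    rw [smul_eq_mul, neg_mul, neg_add_cancel, zero_smul_form]

lemma exists_parallel_submersion (hC : C.IsFlat) (hB : C.ExtendsBott) (x : M) :
    ∃ (U : Opens M) (f : M → ℂ), x ∈ U ∧ IsHolFun E U f ∧ F.IsConormalFrame U (differential f) ∧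
      C.IsParallel U (differential f) := by
  obtain ⟨r, η, hr, hball, hη, hpar⟩ := exists_isParallel hC x
  obtain ⟨f, hf, hdf⟩ := hη.1.exists_primitive hball fun y hy a b ↦
    hpar.closed hB (chartBall_le (E := E) x r) hη hy a b
  refine ⟨chartBall E x r, f, self_mem_chartBall (E := E) hr, hf, ⟨hf.differential, fun y hy ↦ ?_⟩,
    hpar.congr hη.isConormal hdf⟩
  rw [hdf y hy]
  exact hη.2 y hy

/-- Write `df = ρ dg`. Both forms are parallel, so the Leibniz rule gives `v(ρ) dg = 0` for all `v`.
Thus `ρ` is a constant `a`, and `f - a g` has zero differential. -/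
lemma IsParallel.affine {f g : M → ℂ} (hU : IsPreconnected (U : Set M)) (hf : IsHolFun E U f)
    (hg : IsHolFun E U g) (hdf : F.IsConormalFrame U (differential f))
    (hdg : F.IsConormalFrame U (differential g)) (hpf : C.IsParallel U (differential f))
    (hpg : C.IsParallel U (differential g)) :
    ∃ a b : ℂ, a ≠ 0 ∧ ∀ x ∈ U, f x = a * g x + b := by
  have : CompleteSpace E := FiniteDimensional.complete ℂ E
  rcases (U : Set M).eq_empty_or_nonempty with hem | ⟨x₀, hx₀⟩
  · exact ⟨1, 0, one_ne_zero, fun x hx ↦ absurd (show x ∈ (U : Set M) from hx) (by simp [hem])⟩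
  set ρ : M → ℂ := ratio (E := E) (differential g) (differential f)
  have hρ : IsHolFun E U ρ := hdg.isHolFun_ratio hdf.isConormal
  have hρe : ∀ x ∈ U, differential f x = ρ x • differential g x :=
    fun x hx ↦ hdg.ratio_smul hdf.isConormal hx
  have hdρ : ∀ x ∈ U, (differential ρ x : TangentSpace 𝓘(ℂ, E) x →L[ℂ] ℂ) = 0 := by
    intro x hx
    have hxc : x ∈ chartDomain E x := mem_chart_source E x
    ext w
    set v := coordField x (chartDeriv x x w)
    have hv : IsHolField (U ⊓ chartDomain E x) v := (isHolField_coordField x _).mono inf_le_right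
    have h1 := hpf _ inf_le_left v hv x ⟨hx, hxc⟩
    rw [← C.cov_congr hv (.smul (hρ.mono inf_le_left) (hdg.isConormal.mono inf_le_left))
      (fun _ _ ↦ rfl) (fun y hy ↦ hρe y hy.1) ⟨hx, hxc⟩, C.leibniz _ _ _ _ (hρ.mono inf_le_left) hv
      (hdg.isConormal.mono inf_le_left) x ⟨hx, hxc⟩, hpg _ inf_le_left v hv x ⟨hx, hxc⟩, smul_zero_form,
      add_zero, fieldDeriv_eq_differential] at h1
    have h2 := (smul_eq_zero.1 h1).resolve_right (hdg.2 x hx).1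
    rwa [show v x = w from coordField_chartDeriv hxc w] at h2
  set a := ρ x₀
  have ha : ∀ x ∈ U, ρ x = a := fun x hx ↦ hρ.eq_of_differential_eq_zero hU hdρ hx hx₀
  have hag : IsHolFun E U (fun x ↦ a * g x) := (isHolFun_const U a).mul hg
  have h0 : ∀ x ∈ U, (differential (fun x ↦ f x - a * g x) x : TangentSpace 𝓘(ℂ, E) x →L[ℂ] ℂ) = 0 := by
    intro x hx
    rw [differential_sub hf hag hx, differential_mul (isHolFun_const U a) hg hx, differential_const,
      smul_zero_form, add_zero, hρe x hx, ha x hx, sub_self]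
  refine ⟨a, f x₀ - a * g x₀, fun h ↦ ?_, fun x hx ↦ ?_⟩
  · have := hρe x₀ hx₀
    rw [show ρ x₀ = 0 from h, zero_smul_form] at this
    exact (hdf.2 x₀ hx₀).1 this
  · have := (hf.sub hag).eq_of_differential_eq_zero hU h0 hx hx₀
    linear_combination this

/-- Each ball is connected but an intersection of two need not be. The affine comparison is
therefore made on whole balls, against a submersion `f z` defined on both. -/
lemma isTransverselyAffine [T2Space M] [ParacompactSpace M] (hC : C.IsFlat) (hB : C.ExtendsBott) :
    F.IsTransverselyAffine := by
  choose V f hxV hf hdf hpf using fun x ↦ exists_parallel_submersion hC hB x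
  obtain ⟨W, hW, hWV⟩ := exists_star_refinement (fun x ↦ (V x : Set M)) (fun x ↦ (V x).isOpen) hxV
  choose r hr hball hle using fun x : M ↦ exists_chartBall_le (E := E)
    (x := x) (U := V x ⊓ ⟨interior (W x), isOpen_interior⟩) ⟨hxV x, mem_interior_iff_mem_nhds.2 (hW x)⟩
  have hle1 : ∀ x, chartBall E x (r x) ≤ V x := fun x ↦ (hle x).trans inf_le_left
  have hle2 : ∀ x, (chartBall E x (r x) : Set M) ⊆ W x := fun x y hy ↦ interior_subset (hle x hy).2
  have hpre : ∀ x, IsPreconnected (chartBall E x (r x) : Set M) := fun x ↦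
    isPreconnected_chartBall (hball x)
  refine ⟨⟨M, fun x ↦ chartBall E x (r x), f, fun x ↦ ⟨x, self_mem_chartBall (E := E) (hr x)⟩,
    fun x ↦ (hf x).mono (hle1 x), fun x y hy ↦ ?_, fun x y hy w ↦ ((hdf x).2 y (hle1 x hy)).2 w,
    fun x y ↦ ?_⟩⟩
  · exact surjective_of_ne_zero ((hdf x).2 y (hle1 x hy)).1
  · by_cases hne : ((chartBall E x (r x) : Set M) ∩ chartBall E y (r y)).Nonempty
    · obtain ⟨z, hxz, hyz⟩ := hWV x y (hne.mono (Set.inter_subset_inter (hle2 x) (hle2 y)))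
      have key : ∀ x, W x ⊆ V z →
          ∃ a b : ℂ, a ≠ 0 ∧ ∀ y ∈ chartBall E x (r x), f x y = a * f z y + b := fun x hxz ↦
        have hz : chartBall E x (r x) ≤ V z := fun y hy ↦ hxz (hle2 x hy)
        IsParallel.affine (hpre x) ((hf x).mono (hle1 x)) ((hf z).mono hz) ((hdf x).mono (hle1 x))
          ((hdf z).mono hz) ((hpf x).mono (hle1 x)) ((hpf z).mono hz)
      obtain ⟨a, b, ha, h⟩ := key x hxz
      obtain ⟨a', b', ha', h'⟩ := key y hyz
      -- Obtained by eliminating `f z` from `f x = a * f z + b` and `f y = a' * f z + b'`.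
      refine ⟨a / a', b - a / a' * b', div_ne_zero ha ha', fun p hp ↦ ?_⟩
      rw [h p hp.1, h' p hp.2]
      field_simp
      ring
    -- Disjoint balls still need some constants with nonzero slope; the identity map serves.
    · exact ⟨1, 0, one_ne_zero, fun p hp ↦ absurd ⟨p, hp⟩ hne⟩

end ConormalConnection

end CodimOneFoliation

theorem mainTheorem11 {E : Type u} [NormedAddCommGroup E] [NormedSpace ℂ E] [FiniteDimensional ℂ E]
    {M : Type v} [TopologicalSpace M] [T2Space M] [ParacompactSpace M] [ChartedSpace E M]
    [IsManifold 𝓘(ℂ, E) ∞ M] (F : CodimOneFoliation E M) :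
    F.IsTransverselyAffine ↔ ∃ C : F.ConormalConnection, C.IsFlat ∧ C.ExtendsBott :=
  ⟨fun ⟨S⟩ ↦ ⟨S.connection, S.isFlat_connection, S.extendsBott_connection⟩,
    fun ⟨_, hC, hB⟩ ↦ CodimOneFoliation.ConormalConnection.isTransverselyAffine hC hB⟩
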